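/- Let $1/2<H<1$ and let $B=(B_t)_{t\ge 0}$ be an $n$-dimensional fractional Brownian motion with Hurst parameter $H$, defined on a complete probability space $(\Omega,\mathcal F,P)$: its $n$ components are independent centered Gaussian processes with almost surely continuous paths and covariance $\tfrac12\left(s^{2H}+t^{2H}-|t-s|^{2H}\right)$. For $T>0$ and $\gamma\in(0,1)$, let $\mathcal C_1^\gamma([0,T];\mathbb R^m)$ be the space of $f:[0,T]\to\mathbb R^m$ with $\sup_{s\ne t}|f_t-f_s|/|t-s|^\gamma<\infty$. For $\kappa\in(0,1)$, let $\mathcal C^{2,\mathbf b,\kappa}([0,T]^2\times\mathbb R^d;\mathbb R^{d,n})$ be the set of twice continuously differentiable maps $\sigma:[0,T]^2\times\mathbb R^d\to\mathbb R^{d,n}$ (with one-sided derivatives at the boundary) whose first and second derivatives are bounded and whose second derivative is $\kappa$-Hölder continuous. Then there is an event of probability one on which the following holds for every $T>0$ and every $\gamma\in(1/2,H)$. The path $B$ belongs to $\mathcal C_1^\gamma([0,T];\mathbb R^n)$. Moreover, for all $d$, all $\kappa\in(0,1)$ with $\kappa(1+\gamma)>1$, all $a\in\mathbb R^d$ and all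 $\sigma\in\mathcal C^{2,\mathbf b,\kappa}([0,T]^2\times\mathbb R^d;\mathbb R^{d,n})$, the equation $$y_t=a+\int_0^t\sigma(t,u,y_u)\,dB_u,\qquad t\in[0,T],$$ has a unique solution $y$ in $\mathcal C_1^\gamma([0,T];\mathbb R^d)$. Here, for each $t$, the integral is the pathwise Young integral: for $z:[0,T]\to\mathbb R^{d,n}$ and $x:[0,T]\to\mathbb R^n$, $J_{rs}=\int_r^s z_u\,dx_u$ is given by $J_{rs}=z_r(x_s-x_r)-R_{rs}$ for $r,s\in[0,T]$, where $R$ is the unique continuous function on $[0,T]^2$, vanishing on the diagonal, with $\sup_{r\neq s}|R_{rs}|/|s-r|^\mu<\infty$ for some $\mu>1$ and $$R_{rs}-R_{rv}-R_{vs}=-(z_v-z_r)(x_s-x_v)\qquad\text{for all } r,v,s\in[0,T].$$ -/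

import Mathlib

open MeasureTheory ProbabilityTheory Set
open scoped NNReal

namespace YoungVolterra

section Increments

variable {V : Type*} [NormedAddCommGroup V] [NormedSpace ℝ V]

/-- The increment `(δf)_{st} = f_t - f_s` of a path `f`. -/
def delta₁ (f : ℝ → V) (s t : ℝ) : V := f t - f s

/-- The increment `(δg)_{sut} = g_{st} - g_{su} - g_{ut}` of a function `g` of two times. -/
def delta₂ (g : ℝ → ℝ → V) (s u t : ℝ) : V := g s t - g s u - g u t

/-- `g` is in the space `C₂^μ([0, T]; V)`: it is continuous on `[0, T]²`, it vanishes on the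
diagonal, and `sup_{s, t} ‖g_{st}‖ / |t - s|^μ < ∞`. -/
structure MemC₂ (T μ : ℝ) (g : ℝ → ℝ → V) : Prop where
  continuousOn : ContinuousOn (fun p : ℝ × ℝ => g p.1 p.2) (Icc 0 T ×ˢ Icc 0 T)
  diag : ∀ t ∈ Icc 0 T, g t t = 0
  bound : ∃ C : ℝ, ∀ s ∈ Icc 0 T, ∀ t ∈ Icc 0 T, ‖g s t‖ ≤ C * |t - s| ^ μ

/-- `f` is in the Hölder space `C₁^γ([0, T]; V)`, that is `δf ∈ C₂^γ([0, T]; V)`. Only the values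
of `f` on `[0, T]` matter. -/
def MemC₁ (T γ : ℝ) (f : ℝ → V) : Prop := MemC₂ T γ (delta₁ f)

/-- `R = Λh` on `[0, T]`, where `Λ` is the sewing map: `R` is the element of
`⋃_{μ > 1} C₂^μ([0, T]; V)` such that `δR = h`. There is at most one such `R` on `[0, T]²`, because
the difference of two of them is additive and is `O(|t - s|^μ)` with `μ > 1`. -/
def IsSewing (T : ℝ) (h : ℝ → ℝ → ℝ → V) (R : ℝ → ℝ → V) : Prop :=
  (∃ μ : ℝ, 1 < μ ∧ MemC₂ T μ R) ∧
    ∀ s ∈ Icc 0 T, ∀ u ∈ Icc 0 T, ∀ t ∈ Icc 0 T, delta₂ R s u t = h s u t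

variable {W : Type*} [NormedAddCommGroup W] [NormedSpace ℝ W]

/-- `J_{st} = ∫_s^t z_u dx_u` for all `s, t ∈ [0, T]`, as a Young integral defined by sewing:
`J = (Id - Λδ)(z δx)`, where `(z δx)_{st} = z_s (x_t - x_s)`. Since
`(δ(z δx))_{sut} = -(z_u - z_s)(x_t - x_u)`, this is `J_{st} = z_s (δx)_{st} + Λ_{st}(δz δx)`. -/
def IsYoungIntegral (T : ℝ) (z : ℝ → W →L[ℝ] V) (x : ℝ → W) (J : ℝ → ℝ → V) : Prop :=
  ∃ R : ℝ → ℝ → V, IsSewing T (delta₂ fun s t => z s (delta₁ x s t)) R ∧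
    ∀ s ∈ Icc 0 T, ∀ t ∈ Icc 0 T, J s t = z s (delta₁ x s t) - R s t

/-- `y` solves the Young Volterra equation
`y_t = a + ∫_0^t σ(t, u, y_u) dx_u`, `t ∈ [0, T]`. In particular, the Young integral of
`u ↦ σ(t, u, y_u)` against `x` exists for every `t ∈ [0, T]`. -/
def IsSolution (T : ℝ) (σ : ℝ × ℝ × V → W →L[ℝ] V) (a : V) (x : ℝ → W) (y : ℝ → V) : Prop :=
  ∀ t ∈ Icc 0 T, ∃ J : ℝ → ℝ → V,
    IsYoungIntegral T (fun u => σ (t, u, y u)) x J ∧ y t = a + J 0 t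

end Increments

section Coefficients

variable {E F : Type*} [NormedAddCommGroup E] [NormedSpace ℝ E]
  [NormedAddCommGroup F] [NormedSpace ℝ F]

/-- `f` is in the class `C^{k,b,κ}(U; F)`: it is `k` times continuously differentiable on `U`, its
derivatives of orders `1, …, k` are bounded on `U`, and the derivative of order `k` is `κ`-Hölder
on `U`. Derivatives are taken within `U`, so they are one-sided on the boundary if `U` is
closed. -/
structure MemCkbHolder (k : ℕ) (κ : ℝ) (U : Set E) (f : E → F) : Prop where
  contDiffOn : ContDiffOn ℝ k f U
  bounded : ∀ m : ℕ, 1 ≤ m → m ≤ k → ∃ C : ℝ, ∀ p ∈ U, ‖iteratedFDerivWithin ℝ m f U p‖ ≤ C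
  holder : ∃ C : ℝ, ∀ p ∈ U, ∀ q ∈ U,
    ‖iteratedFDerivWithin ℝ k f U p - iteratedFDerivWithin ℝ k f U q‖ ≤ C * ‖p - q‖ ^ κ

end Coefficients

section FractionalBrownianMotion

variable {Ω : Type*} [MeasurableSpace Ω]

/-- `X` is a real fractional Brownian motion with Hurst parameter `H`: a centered Gaussian process
with covariance `(s^{2H} + t^{2H} - |t - s|^{2H}) / 2` and almost surely continuous paths. -/
structure IsFractionalBrownianReal (H : ℝ) (X : ℝ≥0 → Ω → ℝ) (P : Measure Ω) : Prop where
  isGaussianProcess : IsGaussianProcess X P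
  centered : ∀ t, ∫ ω, X t ω ∂P = 0
  covariance : ∀ s t : ℝ≥0, cov[X s, X t; P] =
    ((s : ℝ) ^ (2 * H) + (t : ℝ) ^ (2 * H) - |(t : ℝ) - (s : ℝ)| ^ (2 * H)) / 2
  continuous : ∀ᵐ ω ∂P, Continuous fun t => X t ω

/-- `B` is an `n`-dimensional fractional Brownian motion with Hurst parameter `H`: its components
are independent real fractional Brownian motions with Hurst parameter `H`. -/
structure IsFractionalBrownian {n : ℕ} (H : ℝ) (B : ℝ≥0 → Ω → EuclideanSpace ℝ (Fin n))
    (P : Measure Ω) : Prop where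
  component : ∀ i : Fin n, IsFractionalBrownianReal H (fun t ω => B t ω i) P
  independent : iIndepFun (fun (i : Fin n) (ω : Ω) (t : ℝ≥0) => B t ω i) P

/-- The sample path `t ↦ B_t(ω)`, as a function of a real time; only times `t ≥ 0` matter. -/
def samplePath {W : Type*} (B : ℝ≥0 → Ω → W) (ω : Ω) (t : ℝ) : W := B t.toNNReal ω

end FractionalBrownianMotion

end YoungVolterra

/-!
The equation is solved path by path: fractional Brownian motion only enters through the fact that
almost every path is `γ`-Hölder on every `[0, T]` for every `γ < H`. This is Kolmogorov's criterion
(`IsFractionalBrownianReal.ae_exists_holderBound`): the increment over `[s, t]` is centered Gaussian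
with variance `|t - s|^{2H}`, so all its moments scale, the dyadic increments are controlled by a
convergent series, and continuity of the paths allows chaining (`exists_holderBound_of_dyadic`).

Let now `x` be `γ`-Hölder with `γ > 1/2`. An integral defined by sewing amounts to a path `I` with
`I_t - I_s = z_s (x_t - x_s) + O(|t - s|^ν)` for some `ν > 1` (`IsYoungPath`). Dyadic subdivision
improves such an unspecified remainder to the Young–Loève bound `IsYoungPath.norm_sub_le`, whose
constant depends on the Hölder constants only; uniqueness follows. For existence
(`exists_isYoungPath_of_holder`) the bound is applied to Riemann integrals against the moving
averages of `x` and passes to a limit along an ultrafilter.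

Solutions are the fixed points of `y ↦ (t ↦ a + ∫_0^t σ(t, u, y_u) dx_u)`. The increment of the
right-hand side over `[s, t]` is the sum of `∫_s^t σ(t, u, y_u) dx_u` and of the memory term `∫_0^s
(σ(t, u, y_u) - σ(s, u, y_u)) dx_u`. Both are handled on the whole of `[0, T]` at once with Hölder
seminorms on blocks of length `ε`, the `k`-th of them weighted by `2^{-k}` (`BlockHolder`): sums
over past blocks are then geometric, and every term that depends on the Hölder constant of the
integrand gains a power of `ε` (`blockHolder_volterra`). As the derivatives of `σ` are bounded, a
ball for the exponent `γ` is stable (`exists_invariant`). Differences of two paths are measured with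
the exponent `β = min κ γ ≤ γ`. Their memory term involves a second difference of `∂σ`, which is of
order `|t - s|^κ` times a Hölder increment in `u`, because `D²σ` is `κ`-Hölder
(`IncrementBounds.eight`); this suffices for `β ≤ κ`, and `κ (1 + γ) > 1` gives `β + γ > 1`, so that
the integrals of the differences make sense. The map is thus a contraction for the exponent `β`
(`exists_contraction`), with blocks that may be much shorter than those of the stable ball.
Uniqueness follows at once, and the Picard iterates converge to a solution.
-/

namespace YoungVolterra

open Filter Topology

/-! ### Hölder bounds on an interval -/

section HolderBounds

variable {G : Type*} [NormedAddCommGroup G]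

/-- `f` is `β`-Hölder on `[a, b]` with constant `c`. -/
def HolderBound (a b β c : ℝ) (f : ℝ → G) : Prop :=
  ∀ s t, a ≤ s → s ≤ t → t ≤ b → ‖f t - f s‖ ≤ c * (t - s) ^ β

lemma HolderBound.abs {a b γ C : ℝ} {f : ℝ → G}
    (hf : HolderBound a b γ C f) : HolderBound a b γ |C| f := fun s t h1 h2 h3 =>
  (hf s t h1 h2 h3).trans
    (mul_le_mul_of_nonneg_right (le_abs_self C) (Real.rpow_nonneg (sub_nonneg.2 h2) _))

lemma HolderBound.norm_le_abs {T γ c : ℝ} {f : ℝ → G} (hf : HolderBound 0 T γ c f) {s t : ℝ}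
    (hs : s ∈ Icc 0 T) (ht : t ∈ Icc 0 T) : ‖f t - f s‖ ≤ c * |t - s| ^ γ := by
  rcases le_total s t with h | h
  · rw [abs_of_nonneg (by linarith)]; exact hf s t hs.1 h ht.2
  · rw [abs_sub_comm, abs_of_nonneg (by linarith), norm_sub_rev]; exact hf t s ht.1 h hs.2

lemma continuous_of_holder {f : ℝ → G} {β c : ℝ} (hβ : 0 < β)
    (hf : ∀ s t, s ≤ t → ‖f t - f s‖ ≤ c * (t - s) ^ β) : Continuous f := by
  have habs : ∀ s t, ‖f t - f s‖ ≤ c * |t - s| ^ β := by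
    intro s t
    rcases le_total s t with h | h
    · rw [abs_of_nonneg (by linarith)]; exact hf s t h
    · rw [abs_sub_comm, abs_of_nonneg (by linarith), norm_sub_rev]; exact hf t s h
  rw [continuous_iff_continuousAt]
  intro s
  rw [ContinuousAt, tendsto_iff_norm_sub_tendsto_zero]
  have hlim : Tendsto (fun t : ℝ => c * |t - s| ^ β) (𝓝 s) (𝓝 (c * |s - s| ^ β)) := by
    have : Continuous fun t : ℝ => c * |t - s| ^ β :=
      continuous_const.mul ((by fun_prop : Continuous fun t : ℝ => |t - s|).rpow_const
        fun _ => Or.inr hβ.le)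
    exact this.tendsto s
  rw [sub_self, abs_zero, Real.zero_rpow hβ.ne', mul_zero] at hlim
  exact squeeze_zero (fun _ => norm_nonneg _) (fun t => habs s t) hlim

lemma HolderBound.comp_clamp {f : ℝ → G} {T β c : ℝ} (hT : 0 ≤ T) (hβ : 0 < β) (hc : 0 ≤ c)
    (hf : HolderBound 0 T β c f) {s t : ℝ} (hst : s ≤ t) :
    ‖f (max 0 (min T t)) - f (max 0 (min T s))‖ ≤ c * (t - s) ^ β := by
  have hmono : max 0 (min T s) ≤ max 0 (min T t) := max_le_max le_rfl (min_le_min le_rfl hst)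
  refine (hf _ _ (le_max_left _ _) hmono (max_le hT (min_le_left _ _))).trans ?_
  refine mul_le_mul_of_nonneg_left (Real.rpow_le_rpow (by linarith) ?_ hβ.le) hc
  rcases le_total 0 (min T s) with h1 | h1 <;> rcases le_total 0 (min T t) with h2 | h2 <;>
  rcases le_total T s with h3 | h3 <;> rcases le_total T t with h4 | h4 <;>
  simp_all <;> linarith

lemma HolderBound.continuousOn {T γ c : ℝ} {f : ℝ → G} (hγ : 0 < γ)
    (hf : HolderBound 0 T γ c f) : ContinuousOn f (Icc 0 T) := by
  rcases lt_or_ge T 0 with hT | hT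
  · simp [Icc_eq_empty_of_lt hT]
  have h := continuous_of_holder hγ fun s t => hf.abs.comp_clamp (s := s) (t := t) hT hγ
    (abs_nonneg c)
  refine h.continuousOn.congr fun t ht => ?_
  simp only [min_eq_right ht.2, max_eq_right ht.1]

lemma HolderBound.sub {a b β c c' : ℝ} {f g : ℝ → G} (hf : HolderBound a b β c f)
    (hg : HolderBound a b β c' g) : HolderBound a b β (c + c') fun t => f t - g t := by
  intro s t h1 h2 h3
  rw [sub_sub_sub_comm, add_mul]
  exact (norm_sub_le _ _).trans (add_le_add (hf s t h1 h2 h3) (hg s t h1 h2 h3))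

lemma HolderBound.mono_exponent {T T' γ γ' C : ℝ} {f : ℝ → G}
    (hf : HolderBound 0 T γ C f) (hT : T' ≤ T) (hγ' : 0 < γ') (h : γ' ≤ γ) :
    HolderBound 0 T' γ' (|C| * |T| ^ (γ - γ')) f := by
  intro s t h1 h2 h3
  have hts := sub_nonneg.2 h2
  have e : (t - s) ^ γ = (t - s) ^ (γ - γ') * (t - s) ^ γ' := by
    rw [← Real.rpow_add_of_nonneg hts (by linarith) hγ'.le, sub_add_cancel]
  have e1 : (t - s) ^ (γ - γ') ≤ |T| ^ (γ - γ') :=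
    Real.rpow_le_rpow hts (by linarith [le_abs_self T]) (by linarith)
  have e2 := Real.rpow_nonneg hts γ'
  calc ‖f t - f s‖ ≤ C * (t - s) ^ γ := hf s t h1 h2 (h3.trans hT)
    _ ≤ |C| * (t - s) ^ γ := mul_le_mul_of_nonneg_right (le_abs_self C) (Real.rpow_nonneg hts _)
    _ = |C| * (t - s) ^ (γ - γ') * (t - s) ^ γ' := by rw [e]; ring
    _ ≤ _ := by gcongr

lemma HolderBound.euclidean {n : ℕ} {a b γ : ℝ} {f : ℝ → EuclideanSpace ℝ (Fin n)} {C : Fin n → ℝ}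
    (hf : ∀ i, HolderBound a b γ (C i) fun t => f t i) : HolderBound a b γ (∑ i, C i) f := by
  intro s t h1 h2 h3
  rw [Finset.sum_mul]
  refine le_trans ?_ (Finset.sum_le_sum fun i _ => hf i s t h1 h2 h3)
  rw [EuclideanSpace.norm_eq]
  refine Real.sqrt_le_iff.2 ⟨Finset.sum_nonneg fun _ _ => norm_nonneg _, ?_⟩
  simpa using Finset.sum_sq_le_sq_sum_of_nonneg (s := Finset.univ)
    (f := fun i => ‖f t i - f s i‖) fun _ _ => norm_nonneg _

end HolderBounds

/-! ### The Young integral: sewing bound and uniqueness -/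

section Young

variable {G V W : Type*} [NormedAddCommGroup G] [NormedAddCommGroup V] [NormedSpace ℝ V]
  [NormedAddCommGroup W] [NormedSpace ℝ W]

/-- The constant `∑ₙ 2^{n(1 - μ)}` of the sewing bound. -/
noncomputable def sewConst (μ : ℝ) : ℝ := (1 - 2 ^ (1 - μ))⁻¹

lemma two_rpow_lt_one {μ : ℝ} (hμ : 1 < μ) : (2 : ℝ) ^ (1 - μ) < 1 :=
  Real.rpow_lt_one_of_one_lt_of_neg (by norm_num) (by linarith)

lemma sewConst_pos {μ : ℝ} (hμ : 1 < μ) : 0 < sewConst μ :=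
  inv_pos.2 (by linarith [two_rpow_lt_one hμ])

lemma sewConst_eq {μ : ℝ} (hμ : 1 < μ) : sewConst μ = 1 + 2 ^ (1 - μ) * sewConst μ := by
  have h := two_rpow_lt_one hμ
  have : (1 - (2 : ℝ) ^ (1 - μ)) ≠ 0 := by linarith
  unfold sewConst
  field_simp
  ring

lemma two_mul_half_rpow {x μ : ℝ} (hx : 0 ≤ x) : 2 * (x / 2) ^ μ = 2 ^ (1 - μ) * x ^ μ := by
  rw [Real.div_rpow hx (by norm_num), Real.rpow_sub (by norm_num), Real.rpow_one]
  ring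

/-- **Sewing bound.** If the defect of additivity of `R` is at most `c (t - s)^μ` and `R` is
`O((t - s)^ν)` with `μ, ν > 1`, then `R` is bounded in terms of `c` and `μ` alone: cutting `[s, t]`
dyadically `n` times multiplies the contribution of the a priori bound by `2^{n(1 - ν)}`. -/
lemma norm_le_of_almost_additive {R : ℝ → ℝ → G} {a b μ ν c C : ℝ} (hμ : 1 < μ) (hν : 1 < ν)
    (hadd : ∀ s u t, a ≤ s → s ≤ u → u ≤ t → t ≤ b →
      ‖R s t - R s u - R u t‖ ≤ c * (t - s) ^ μ)
    (hR : ∀ s t, a ≤ s → s ≤ t → t ≤ b → ‖R s t‖ ≤ C * (t - s) ^ ν) {s t : ℝ}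
    (has : a ≤ s) (hst : s ≤ t) (htb : t ≤ b) : ‖R s t‖ ≤ sewConst μ * c * (t - s) ^ μ := by
  have key : ∀ n : ℕ, ∀ s t, a ≤ s → s ≤ t → t ≤ b →
      ‖R s t‖ ≤ sewConst μ * c * (t - s) ^ μ + C * ((2 : ℝ) ^ (1 - ν)) ^ n * (t - s) ^ ν := by
    intro n
    induction n with
    | zero =>
      intro s t has hst htb
      have h0 : 0 ≤ c * (t - s) ^ μ := (norm_nonneg _).trans (hadd s s t has le_rfl hst htb)
      have := hR s t has hst htb
      have h1 : 0 ≤ sewConst μ * (c * (t - s) ^ μ) := mul_nonneg (sewConst_pos hμ).le h0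
      rw [pow_zero, mul_one]
      linarith
    | succ n ih =>
      intro s t has hst htb
      have hm1 : s ≤ (s + t) / 2 := by linarith
      have hm2 : (s + t) / 2 ≤ t := by linarith
      have h1 := ih s ((s + t) / 2) has hm1 (by linarith)
      have h2 := ih ((s + t) / 2) t (by linarith) hm2 htb
      have h3 := hadd s ((s + t) / 2) t has hm1 hm2 htb
      have e1 : (s + t) / 2 - s = (t - s) / 2 := by ring
      have e2 : t - (s + t) / 2 = (t - s) / 2 := by ring
      rw [e1] at h1
      rw [e2] at h2
      have hn : ‖R s t‖ ≤ ‖R s t - R s ((s + t) / 2) - R ((s + t) / 2) t‖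
          + ‖R s ((s + t) / 2)‖ + ‖R ((s + t) / 2) t‖ := by
        have : R s t = (R s t - R s ((s + t) / 2) - R ((s + t) / 2) t)
          + R s ((s + t) / 2) + R ((s + t) / 2) t := by abel
        calc ‖R s t‖ = ‖(R s t - R s ((s + t) / 2) - R ((s + t) / 2) t)
          + R s ((s + t) / 2) + R ((s + t) / 2) t‖ := by rw [← this]
          _ ≤ _ := norm_add₃_le
      have hts : 0 ≤ t - s := by linarith
      have p1 := two_mul_half_rpow (μ := μ) hts
      have p2 := two_mul_half_rpow (μ := ν) hts
      calc ‖R s t‖ ≤ c * (t - s) ^ μ + sewConst μ * c * (2 * ((t - s) / 2) ^ μ)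
            + C * ((2 : ℝ) ^ (1 - ν)) ^ n * (2 * ((t - s) / 2) ^ ν) := by linarith
        _ = (1 + 2 ^ (1 - μ) * sewConst μ) * c * (t - s) ^ μ
            + C * ((2 : ℝ) ^ (1 - ν)) ^ (n + 1) * (t - s) ^ ν := by rw [p1, p2]; ring
        _ = _ := by rw [← sewConst_eq hμ]
  have hlim : Tendsto (fun n : ℕ => sewConst μ * c * (t - s) ^ μ
      + C * ((2 : ℝ) ^ (1 - ν)) ^ n * (t - s) ^ ν) atTop
      (𝓝 (sewConst μ * c * (t - s) ^ μ + C * 0 * (t - s) ^ ν)) :=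
    (((tendsto_pow_atTop_nhds_zero_of_lt_one (by positivity)
      (two_rpow_lt_one hν)).const_mul C).mul_const _).const_add _
  rw [mul_zero, zero_mul, add_zero] at hlim
  exact ge_of_tendsto' hlim fun n => key n s t has hst htb

/-- `I` is a primitive on `[a, b]` of `z` against `x` in the sense of Young: its increments are
those of the Riemann sums `z_s (x_t - x_s)` up to `O((t - s)^ν)` for some `ν > 1`. -/
def IsYoungPath (a b : ℝ) (z : ℝ → W →L[ℝ] V) (x : ℝ → W) (I : ℝ → V) : Prop :=
  ∃ ν : ℝ, 1 < ν ∧ ∃ C : ℝ, ∀ s t, a ≤ s → s ≤ t → t ≤ b →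
    ‖I t - I s - z s (x t - x s)‖ ≤ C * (t - s) ^ ν

lemma rpow_mul_rpow_le {u v r β γ : ℝ} (hu : 0 ≤ u) (hv : 0 ≤ v) (hur : u ≤ r) (hvr : v ≤ r)
    (hβ : 0 < β) (hγ : 0 < γ) : u ^ β * v ^ γ ≤ r ^ (β + γ) := by
  rw [Real.rpow_add_of_nonneg (hu.trans hur) hβ.le hγ.le]
  exact mul_le_mul (Real.rpow_le_rpow hu hur hβ.le) (Real.rpow_le_rpow hv hvr hγ.le)
    (Real.rpow_nonneg hv _) (Real.rpow_nonneg (hu.trans hur) _)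

/-- **Young–Loève inequality.** -/
lemma IsYoungPath.norm_sub_le {a b β γ cz cx : ℝ} {z : ℝ → W →L[ℝ] V} {x : ℝ → W} {I : ℝ → V}
    (hI : IsYoungPath a b z x I) (hβ : 0 < β) (hγ : 0 < γ) (hβγ : 1 < β + γ) (hcz : 0 ≤ cz)
    (hcx : 0 ≤ cx) (hz : HolderBound a b β cz z) (hx : HolderBound a b γ cx x) {s t : ℝ}
    (has : a ≤ s) (hst : s ≤ t) (htb : t ≤ b) :
    ‖I t - I s - z s (x t - x s)‖ ≤ sewConst (β + γ) * (cz * cx) * (t - s) ^ (β + γ) := by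
  obtain ⟨ν, hν, C, hC⟩ := hI
  refine norm_le_of_almost_additive (R := fun s t => I t - I s - z s (x t - x s)) (a := a) (b := b)
    hβγ hν ?_ hC has hst htb
  intro s u t has hsu hut htb
  have e : (I t - I s - z s (x t - x s)) - (I u - I s - z s (x u - x s))
      - (I t - I u - z u (x t - x u)) = (z u - z s) (x t - x u) := by
    simp only [map_sub, sub_apply]
    abel
  simp only [e]
  have h1 := hz s u has hsu (hut.trans htb)
  have h2 := hx u t (has.trans hsu) hut htb
  have hu : 0 ≤ u - s := by linarith
  calc ‖(z u - z s) (x t - x u)‖ ≤ ‖z u - z s‖ * ‖x t - x u‖ := ContinuousLinearMap.le_opNorm _ _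
    _ ≤ (cz * (u - s) ^ β) * (cx * (t - u) ^ γ) :=
        mul_le_mul h1 h2 (norm_nonneg _) (mul_nonneg hcz (Real.rpow_nonneg hu _))
    _ = cz * ((u - s) ^ β * (cx * (t - u) ^ γ)) := by ring
    _ ≤ cz * (cx * (t - s) ^ (β + γ)) := by
        refine mul_le_mul_of_nonneg_left ?_ hcz
        calc (u - s) ^ β * (cx * (t - u) ^ γ) = cx * ((u - s) ^ β * (t - u) ^ γ) := by ring
          _ ≤ _ := mul_le_mul_of_nonneg_left (rpow_mul_rpow_le hu (by linarith) (by linarith)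
            (by linarith) hβ hγ) hcx
    _ = cz * cx * (t - s) ^ (β + γ) := by ring

lemma IsYoungPath.mono {a b a' b' : ℝ} {z : ℝ → W →L[ℝ] V} {x : ℝ → W} {I : ℝ → V}
    (hI : IsYoungPath a b z x I) (ha : a ≤ a') (hb : b' ≤ b) : IsYoungPath a' b' z x I := by
  obtain ⟨ν, hν, C, hC⟩ := hI
  exact ⟨ν, hν, C, fun s t h1 h2 h3 => hC s t (ha.trans h1) h2 (h3.trans hb)⟩

lemma IsYoungPath.sub {a b : ℝ} {z z' : ℝ → W →L[ℝ] V} {x : ℝ → W} {I I' : ℝ → V}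
    (hI : IsYoungPath a b z x I) (hI' : IsYoungPath a b z' x I') :
    IsYoungPath a b (fun u => z u - z' u) x (fun u => I u - I' u) := by
  obtain ⟨ν, hν, C, hC⟩ := hI
  obtain ⟨ν', hν', C', hC'⟩ := hI'
  -- lower both exponents to their minimum, at the price of a power of the length of `[a, b]`
  have aux : ∀ C r ν ρ : ℝ, 0 ≤ r → r ≤ b - a → 1 < ρ → ρ ≤ ν →
      C * r ^ ν ≤ |C| * (b - a) ^ (ν - ρ) * r ^ ρ := by
    intro C r ν ρ hr hrb hρ hρν
    have h1 : r ^ ν = r ^ (ν - ρ) * r ^ ρ := by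
      rw [← Real.rpow_add_of_nonneg hr (by linarith) (by linarith)]
      congr 1; ring
    calc C * r ^ ν ≤ |C| * r ^ ν := mul_le_mul_of_nonneg_right (le_abs_self C)
          (Real.rpow_nonneg hr _)
      _ = |C| * r ^ (ν - ρ) * r ^ ρ := by rw [h1]; ring
      _ ≤ _ := by
        have := Real.rpow_le_rpow hr hrb (by linarith : 0 ≤ ν - ρ)
        have h3 := Real.rpow_nonneg hr ρ
        gcongr
  refine ⟨min ν ν', lt_min hν hν', |C| * (b - a) ^ (ν - min ν ν')
    + |C'| * (b - a) ^ (ν' - min ν ν'), fun s t has hst htb => ?_⟩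
  have e : (I t - I' t) - (I s - I' s) - (z s - z' s) (x t - x s)
      = (I t - I s - z s (x t - x s)) - (I' t - I' s - z' s (x t - x s)) := by
    simp only [sub_apply]; abel
  have h1 := (hC s t has hst htb).trans
    (aux C (t - s) ν (min ν ν') (by linarith) (by linarith) (lt_min hν hν') (min_le_left _ _))
  have h2 := (hC' s t has hst htb).trans
    (aux C' (t - s) ν' (min ν ν') (by linarith) (by linarith) (lt_min hν hν') (min_le_right _ _))
  simp only [e]
  refine (_root_.norm_sub_le _ _).trans ?_
  rw [add_mul]
  exact add_le_add h1 h2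

/-- Young primitives are unique up to a constant. -/
lemma IsYoungPath.eq_of_eqOn {a b : ℝ} {z z' : ℝ → W →L[ℝ] V} {x : ℝ → W} {I I' : ℝ → V}
    (hI : IsYoungPath a b z x I) (hI' : IsYoungPath a b z' x I')
    (hz : ∀ t, a ≤ t → t ≤ b → z t = z' t) {t : ℝ} (hat : a ≤ t) (htb : t ≤ b) :
    I t - I a = I' t - I' a := by
  obtain ⟨ν, hν, C, hC⟩ := hI.sub hI'
  have key : ‖(I t - I' t) - (I a - I' a)‖ ≤ sewConst 2 * 0 * (t - a) ^ (2 : ℝ) := by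
    refine norm_le_of_almost_additive (R := fun s t => (I t - I' t) - (I s - I' s)) (a := a)
      (b := b) (C := C) one_lt_two hν (fun s u t _ _ _ _ => ?_) (fun s t h1 h2 h3 => ?_)
      le_rfl hat htb
    · simp
    · have := hC s t h1 h2 h3
      simpa [hz s h1 (h2.trans h3)] using this
  simp only [mul_zero, zero_mul, norm_le_zero_iff] at key
  rw [← sub_eq_zero, ← key]
  abel

/-! ### The Young integral: existence -/

/-- The average of `x` over `[t, t + h]`, normalized to vanish at `0`. -/
noncomputable def steklov (x : ℝ → W) (h t : ℝ) : W := ∫ u in 0..t, h⁻¹ • (x (u + h) - x u)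

lemma steklov_sub {x : ℝ → W} (hx : Continuous x) (h s t : ℝ) :
    steklov x h t - steklov x h s = h⁻¹ • ∫ v in 0..h, (x (t + v) - x (s + v)) := by
  have hi : ∀ a b : ℝ, IntervalIntegrable x volume a b := fun a b => hx.intervalIntegrable a b
  have hc : Continuous fun u => h⁻¹ • (x (u + h) - x u) := by fun_prop
  unfold steklov
  rw [intervalIntegral.integral_interval_sub_left (hc.intervalIntegrable _ _)
    (hc.intervalIntegrable _ _), intervalIntegral.integral_smul,
    intervalIntegral.integral_sub ((by fun_prop : Continuous fun u => x (u + h)).intervalIntegrable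
      _ _) (hi _ _),
    intervalIntegral.integral_sub ((by fun_prop : Continuous fun v => x (t + v)).intervalIntegrable
      _ _) ((by fun_prop : Continuous fun v => x (s + v)).intervalIntegrable _ _)]
  rw [intervalIntegral.integral_comp_add_right (fun u => x u),
    intervalIntegral.integral_comp_add_left (fun u => x u),
    intervalIntegral.integral_comp_add_left (fun u => x u),
    intervalIntegral.integral_interval_sub_interval_comm' (hi _ _) (hi _ _) (hi _ _)]
  simp

lemma norm_steklov_sub_le {x : ℝ → W} {γ cx h : ℝ} (hγ : 0 < γ) (hh : 0 < h)
    (hx : ∀ s t, s ≤ t → ‖x t - x s‖ ≤ cx * (t - s) ^ γ) {s t : ℝ} (hst : s ≤ t) :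
    ‖steklov x h t - steklov x h s‖ ≤ cx * (t - s) ^ γ := by
  rw [steklov_sub (continuous_of_holder hγ hx), norm_smul, norm_inv, Real.norm_of_nonneg hh.le]
  have : ‖∫ v in 0..h, (x (t + v) - x (s + v))‖ ≤ cx * (t - s) ^ γ * |h - 0| := by
    refine intervalIntegral.norm_integral_le_of_norm_le_const fun v _ => ?_
    have := hx (s + v) (t + v) (by linarith)
    rwa [add_sub_add_right_eq_sub] at this
  rw [sub_zero, abs_of_pos hh] at this
  rw [inv_mul_le_iff₀ hh, mul_comm h]
  exact this

lemma tendsto_steklov_sub [CompleteSpace W] {x : ℝ → W} (hx : Continuous x) (s t : ℝ) :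
    Tendsto (fun h => steklov x h t - steklov x h s) (𝓝[>] 0) (𝓝 (x t - x s)) := by
  have hc : Continuous fun v => x (t + v) - x (s + v) := by fun_prop
  have hd := intervalIntegral.integral_hasDerivAt_right (hc.intervalIntegrable 0 0)
    (hc.stronglyMeasurableAtFilter _ _) hc.continuousAt
  have := hd.tendsto_slope_zero_right
  simp only [zero_add, add_zero, intervalIntegral.integral_same, sub_zero] at this
  exact this.congr fun h => (steklov_sub hx h s t).symm

/-- The Riemann integral of `z` against the `C¹` path `steklov x h` is a Young primitive. -/
lemma isYoungPath_steklov [CompleteSpace W] [CompleteSpace V] {z : ℝ → W →L[ℝ] V} {x : ℝ → W}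
    {β γ cz cx h : ℝ} (hβ : 0 < β) (hγ : 0 < γ) (hh : 0 < h) (hcz : 0 ≤ cz)
    (hz : ∀ s t, s ≤ t → ‖z t - z s‖ ≤ cz * (t - s) ^ β)
    (hx : ∀ s t, s ≤ t → ‖x t - x s‖ ≤ cx * (t - s) ^ γ) (a b : ℝ) :
    IsYoungPath a b z (steklov x h) fun t => ∫ u in 0..t, z u (h⁻¹ • (x (u + h) - x u)) := by
  have hzc := continuous_of_holder hβ hz
  have hxc := continuous_of_holder hγ hx
  have hc : Continuous fun u => h⁻¹ • (x (u + h) - x u) := by fun_prop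
  have hzx : Continuous fun u => z u (h⁻¹ • (x (u + h) - x u)) := hzc.clm_apply hc
  refine ⟨1 + β, by linarith, cz * (h⁻¹ * (cx * h ^ γ)), fun s t _ hst _ => ?_⟩
  have hzs : Continuous fun u => z s (h⁻¹ • (x (u + h) - x u)) := (z s).continuous.comp hc
  have hsteklov : steklov x h t - steklov x h s = ∫ u in s..t, h⁻¹ • (x (u + h) - x u) :=
    intervalIntegral.integral_interval_sub_left (hc.intervalIntegrable _ _)
      (hc.intervalIntegrable _ _)
  rw [intervalIntegral.integral_interval_sub_left (hzx.intervalIntegrable _ _)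
    (hzx.intervalIntegrable _ _), hsteklov,
    ← ContinuousLinearMap.intervalIntegral_comp_comm _ (hc.intervalIntegrable _ _),
    ← intervalIntegral.integral_sub (hzx.intervalIntegrable _ _)
      (hzs.intervalIntegrable _ _)]
  have hts : 0 ≤ t - s := by linarith
  have hb : ∀ u ∈ uIoc s t, ‖z u (h⁻¹ • (x (u + h) - x u)) - z s (h⁻¹ • (x (u + h) - x u))‖
      ≤ cz * (t - s) ^ β * (h⁻¹ * (cx * h ^ γ)) := by
    intro u hu
    rw [uIoc_of_le hst] at hu
    rw [← sub_apply]
    refine (ContinuousLinearMap.le_opNorm _ _).trans ?_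
    have h1 : ‖z u - z s‖ ≤ cz * (t - s) ^ β := (hz s u hu.1.le).trans
      (mul_le_mul_of_nonneg_left (Real.rpow_le_rpow (by linarith [hu.1]) (by linarith [hu.2])
        hβ.le) hcz)
    have h2 : ‖h⁻¹ • (x (u + h) - x u)‖ ≤ h⁻¹ * (cx * h ^ γ) := by
      rw [norm_smul, norm_inv, Real.norm_of_nonneg hh.le]
      have := hx u (u + h) (by linarith)
      rw [add_sub_cancel_left] at this
      exact mul_le_mul_of_nonneg_left this (inv_nonneg.2 hh.le)
    exact mul_le_mul h1 h2 (norm_nonneg _) ((norm_nonneg _).trans h1)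
  refine (intervalIntegral.norm_integral_le_of_norm_le_const hb).trans (le_of_eq ?_)
  rw [abs_of_nonneg hts, Real.rpow_add_of_nonneg hts zero_le_one hβ.le, Real.rpow_one]
  ring

/-- **Existence of the Young integral.** The Riemann integrals of `z` against the mollified paths
`steklov x h` satisfy the Young–Loève inequality uniformly in `h`; being bounded in a proper space,
they have a limit along an ultrafilter, and the inequality passes to the limit. -/
lemma exists_isYoungPath_of_holder [CompleteSpace W] [ProperSpace V] {z : ℝ → W →L[ℝ] V}
    {x : ℝ → W} {β γ cz cx : ℝ} (hβ : 0 < β) (hγ : 0 < γ) (hβγ : 1 < β + γ) (hcz : 0 ≤ cz)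
    (hcx : 0 ≤ cx) (hz : ∀ s t, s ≤ t → ‖z t - z s‖ ≤ cz * (t - s) ^ β)
    (hx : ∀ s t, s ≤ t → ‖x t - x s‖ ≤ cx * (t - s) ^ γ) (T : ℝ) :
    ∃ I : ℝ → V, I 0 = 0 ∧ IsYoungPath 0 T z x I := by
  set h : ℕ → ℝ := fun n => 1 / ((n : ℝ) + 1) with h_def
  have hpos : ∀ n, 0 < h n := fun n => Nat.one_div_pos_of_nat
  have hlim : Tendsto h atTop (𝓝[>] 0) :=
    tendsto_nhdsWithin_iff.2 ⟨tendsto_one_div_add_atTop_nhds_zero_nat, .of_forall hpos⟩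
  set J : ℕ → ℝ → V := fun n t => ∫ u in 0..t, z u ((h n)⁻¹ • (x (u + h n) - x u)) with J_def
  have hJ : ∀ n s t, 0 ≤ s → s ≤ t → t ≤ T →
      ‖J n t - J n s - z s (steklov x (h n) t - steklov x (h n) s)‖
        ≤ sewConst (β + γ) * (cz * cx) * (t - s) ^ (β + γ) := fun n s t hs hst htT =>
    (isYoungPath_steklov hβ hγ (hpos n) hcz hz hx 0 T).norm_sub_le hβ hγ hβγ hcz hcx
      (fun s t _ hst _ => hz s t hst) (fun s t _ hst _ => norm_steklov_sub_le hγ (hpos n) hx hst)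
      hs hst htT
  have hbdd : ∀ t, 0 ≤ t → t ≤ T → ∀ n, J n t ∈ Metric.closedBall (0 : V)
      (sewConst (β + γ) * (cz * cx) * (t - 0) ^ (β + γ) + ‖z 0‖ * (cx * (t - 0) ^ γ)) := by
    intro t ht htT n
    have h1 := hJ n 0 t le_rfl ht htT
    have h2 := norm_steklov_sub_le hγ (hpos n) hx ht
    have h3 := (z 0).le_opNorm (steklov x (h n) t - steklov x (h n) 0)
    have h4 := mul_le_mul_of_nonneg_left h2 (norm_nonneg (z 0))
    have h5 : J n 0 = 0 := intervalIntegral.integral_same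
    rw [h5, sub_zero] at h1
    rw [mem_closedBall_zero_iff]
    calc ‖J n t‖ = ‖(J n t - z 0 (steklov x (h n) t - steklov x (h n) 0))
          + z 0 (steklov x (h n) t - steklov x (h n) 0)‖ := by rw [sub_add_cancel]
      _ ≤ _ := (norm_add_le _ _).trans (add_le_add h1 (h3.trans h4))
  have hex : ∀ t, 0 ≤ t → t ≤ T → ∃ l, Tendsto (fun n => J n t) (hyperfilter ℕ) (𝓝 l) := by
    intro t ht htT
    obtain ⟨l, -, hl⟩ := (isCompact_closedBall (0 : V) _).ultrafilter_le_nhds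
      ((hyperfilter ℕ).map fun n => J n t)
      (le_principal_iff.2 (mem_map.2 (univ_mem' (hbdd t ht htT))))
    exact ⟨l, hl⟩
  choose! I hI using hex
  have hU : ((hyperfilter ℕ : Ultrafilter ℕ) : Filter ℕ) ≤ atTop := Nat.hyperfilter_le_atTop
  have key : ∀ s t, 0 ≤ s → s ≤ t → t ≤ T → ‖I t - I s - z s (x t - x s)‖
      ≤ sewConst (β + γ) * (cz * cx) * (t - s) ^ (β + γ) := by
    intro s t hs hst htT
    have h1 := ((hI t (hs.trans hst) htT).sub (hI s hs (hst.trans htT))).sub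
      (((z s).continuous.tendsto _).comp
        (((tendsto_steklov_sub (continuous_of_holder hγ hx) s t).comp hlim).mono_left hU))
    exact le_of_tendsto h1.norm (Eventually.of_forall fun n => hJ n s t hs hst htT)
  refine ⟨fun t => I t - I 0, sub_self _, β + γ, hβγ, sewConst (β + γ) * (cz * cx),
    fun s t hs hst htT => ?_⟩
  rw [sub_sub_sub_cancel_right]
  exact key s t hs hst htT

/-- Existence for Hölder functions on `[0, T]`, extended to the line as constants outside. -/
lemma exists_isYoungPath [CompleteSpace W] [ProperSpace V] {z : ℝ → W →L[ℝ] V}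
    {x : ℝ → W} {T β γ cz cx : ℝ} (hT : 0 ≤ T) (hβ : 0 < β) (hγ : 0 < γ) (hβγ : 1 < β + γ)
    (hcz : 0 ≤ cz) (hcx : 0 ≤ cx) (hz : HolderBound 0 T β cz z) (hx : HolderBound 0 T γ cx x) :
    ∃ I : ℝ → V, I 0 = 0 ∧ IsYoungPath 0 T z x I := by
  obtain ⟨I, hI0, ν, hν, C, hC⟩ := exists_isYoungPath_of_holder hβ hγ hβγ hcz hcx
    (fun s t => hz.comp_clamp hT hβ hcz) (fun s t => hx.comp_clamp hT hγ hcx) T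
  have hclamp : ∀ t, 0 ≤ t → t ≤ T → max 0 (min T t) = t := fun t h0 h1 => by
    rw [min_eq_right h1, max_eq_right h0]
  refine ⟨I, hI0, ν, hν, C, fun s t hs hst htT => ?_⟩
  have := hC s t hs hst htT
  simpa only [hclamp s hs (hst.trans htT), hclamp t (hs.trans hst) htT] using this

/-! ### Integrals defined by sewing -/

lemma MemC₁.exists_holderBound {T γ : ℝ} {f : ℝ → G} (hf : MemC₁ T γ f) :
    ∃ c, 0 ≤ c ∧ HolderBound 0 T γ c f := by
  obtain ⟨C, hC⟩ := hf.bound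
  refine ⟨|C|, abs_nonneg _, fun s t hs hst htT => ?_⟩
  have := hC s ⟨hs, hst.trans htT⟩ t ⟨hs.trans hst, htT⟩
  rw [abs_of_nonneg (sub_nonneg.2 hst)] at this
  exact this.trans (mul_le_mul_of_nonneg_right (le_abs_self C)
    (Real.rpow_nonneg (sub_nonneg.2 hst) _))

lemma HolderBound.continuousOn_delta₁ {T γ c : ℝ} {f : ℝ → G} (hγ : 0 < γ)
    (hf : HolderBound 0 T γ c f) :
    ContinuousOn (fun p : ℝ × ℝ => delta₁ f p.1 p.2) (Icc 0 T ×ˢ Icc 0 T) :=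
  ((hf.continuousOn hγ).comp continuousOn_snd fun _ hp => hp.2).sub
    ((hf.continuousOn hγ).comp continuousOn_fst fun _ hp => hp.1)

lemma HolderBound.memC₁ {T γ c : ℝ} {f : ℝ → G} (hγ : 0 < γ)
    (hf : HolderBound 0 T γ c f) : MemC₁ T γ f where
  continuousOn := hf.continuousOn_delta₁ hγ
  diag _ _ := sub_self _
  bound := ⟨c, fun _ hs _ ht => hf.norm_le_abs hs ht⟩

/-- An integral defined by sewing is additive, and its increments are those of a Young
primitive. -/
lemma IsYoungIntegral.isYoungPath {T : ℝ} (hT : 0 ≤ T) {z : ℝ → W →L[ℝ] V} {x : ℝ → W}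
    {J : ℝ → ℝ → V} (hJ : IsYoungIntegral T z x J) :
    J 0 0 = 0 ∧ IsYoungPath 0 T z x fun t => J 0 t := by
  obtain ⟨R, ⟨⟨μ, hμ, hR⟩, hδ⟩, hJR⟩ := hJ
  have h0 : (0 : ℝ) ∈ Icc 0 T := ⟨le_rfl, hT⟩
  obtain ⟨C, hC⟩ := hR.bound
  refine ⟨by simp [hJR 0 h0 0 h0, hR.diag 0 h0, delta₁], μ, hμ, C, fun s t hs hst htT => ?_⟩
  have hs' : s ∈ Icc 0 T := ⟨hs, hst.trans htT⟩
  have ht' : t ∈ Icc 0 T := ⟨hs.trans hst, htT⟩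
  have h1 := hδ 0 h0 s hs' t ht'
  have h2 : J 0 t - J 0 s - z s (x t - x s) = - R s t := by
    rw [hJR 0 h0 t ht', hJR 0 h0 s hs']
    simp only [delta₂, delta₁, map_sub] at h1 ⊢
    rw [← sub_eq_zero] at h1 ⊢
    rw [← neg_eq_zero, ← h1]
    abel
  simp only [h2, norm_neg]
  simpa [abs_of_nonneg (sub_nonneg.2 hst)] using hC s hs' t ht'

lemma IsYoungPath.isYoungIntegral {T β γ cz cx : ℝ} {z : ℝ → W →L[ℝ] V} {x : ℝ → W} {I : ℝ → V}
    (hI : IsYoungPath 0 T z x I) (hβ : 0 < β) (hγ : 0 < γ) (hβγ : 1 < β + γ) (hcz : 0 ≤ cz)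
    (hcx : 0 ≤ cx) (hz : HolderBound 0 T β cz z) (hx : HolderBound 0 T γ cx x)
    (hIc : ContinuousOn I (Icc 0 T)) :
    IsYoungIntegral T z x fun s t => I t - I s := by
  refine ⟨fun s t => z s (delta₁ x s t) - (I t - I s), ⟨⟨β + γ, hβγ, ?_, ?_, ?_⟩, ?_⟩, ?_⟩
  · refine ContinuousOn.sub (ContinuousOn.clm_apply ((hz.continuousOn hβ).comp continuousOn_fst
      fun _ hp => hp.1) (hx.continuousOn_delta₁ hγ)) (ContinuousOn.sub
      (hIc.comp continuousOn_snd fun _ hp => hp.2) (hIc.comp continuousOn_fst fun _ hp => hp.1))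
  · intro t _
    simp [delta₁]
  · have key : ∀ s t, 0 ≤ s → s ≤ t → t ≤ T → ‖z s (delta₁ x s t) - (I t - I s)‖
        ≤ sewConst (β + γ) * (cz * cx) * (t - s) ^ (β + γ) := fun s t hs hst htT => by
      rw [norm_sub_rev]
      exact hI.norm_sub_le hβ hγ hβγ hcz hcx hz hx hs hst htT
    refine ⟨(sewConst (β + γ) + 1) * (cz * cx), fun s hs t ht => ?_⟩
    rcases le_total s t with h | h
    · rw [abs_of_nonneg (by linarith)]
      refine (key s t hs.1 h ht.2).trans (mul_le_mul_of_nonneg_right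
        (mul_le_mul_of_nonneg_right (by linarith) (by positivity))
        (Real.rpow_nonneg (by linarith) _))
    · rw [abs_sub_comm, abs_of_nonneg (by linarith)]
      have e : z s (delta₁ x s t) - (I t - I s)
          = (z s - z t) (x t - x s) - (z t (delta₁ x t s) - (I s - I t)) := by
        simp only [delta₁, map_sub, sub_apply]; abel
      have h1 := key t s ht.1 h hs.2
      have h2 : ‖(z s - z t) (x t - x s)‖ ≤ cz * cx * (s - t) ^ (β + γ) := by
        have hst : 0 ≤ s - t := by linarith
        calc ‖(z s - z t) (x t - x s)‖ ≤ ‖z s - z t‖ * ‖x t - x s‖ :=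
              ContinuousLinearMap.le_opNorm _ _
          _ ≤ (cz * (s - t) ^ β) * (cx * (s - t) ^ γ) := by
              rw [norm_sub_rev (x t)]
              exact mul_le_mul (hz t s ht.1 h hs.2) (hx t s ht.1 h hs.2) (norm_nonneg _)
                (by positivity)
          _ = _ := by rw [Real.rpow_add_of_nonneg hst hβ.le hγ.le]; ring
      rw [e]
      refine (_root_.norm_sub_le _ _).trans ((add_le_add h2 h1).trans (le_of_eq ?_))
      ring
  · intro s _ u _ t _
    simp only [delta₂]; abel
  · intro s _ t _
    simp

end Young

/-! ### Increments of the coefficient -/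

section CoefficientEstimates

variable {E F : Type*} [NormedAddCommGroup E] [NormedSpace ℝ E]
  [NormedAddCommGroup F] [NormedSpace ℝ F]

/-- Second-order increments of a function with bounded Lipschitz derivative, from the mean value
inequality along the segments from `q₂` to `q₁` and from `q₄` to `q₃`. -/
lemma norm_four_point_le {f : E → F} {f' : E → E →L[ℝ] F} {S : Set E} (hS : Convex ℝ S)
    {L₁ L₂ : ℝ} (hL₂ : 0 ≤ L₂) (hf : ∀ q ∈ S, HasFDerivWithinAt f (f' q) S q)
    (hb : ∀ q ∈ S, ‖f' q‖ ≤ L₁) (hlip : ∀ q ∈ S, ∀ q' ∈ S, ‖f' q - f' q'‖ ≤ L₂ * ‖q - q'‖)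
    {q₁ q₂ q₃ q₄ : E} (h₁ : q₁ ∈ S) (h₂ : q₂ ∈ S) (h₃ : q₃ ∈ S) (h₄ : q₄ ∈ S) :
    ‖f q₁ - f q₂ - (f q₃ - f q₄)‖ ≤ L₁ * ‖q₁ - q₂ - (q₃ - q₄)‖
      + L₂ * (max ‖q₁ - q₃‖ ‖q₂ - q₄‖ * ‖q₃ - q₄‖) := by
  have hseg : ∀ {p q : E}, p ∈ S → q ∈ S → ∀ r ∈ Icc (0 : ℝ) 1, q + r • (p - q) ∈ S :=
    fun hp hq r hr => hS.add_smul_sub_mem hq hp hr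
  have hder : ∀ {p q : E}, p ∈ S → q ∈ S → ∀ r ∈ Icc (0 : ℝ) 1,
      HasDerivWithinAt (fun r : ℝ => f (q + r • (p - q))) (f' (q + r • (p - q)) (p - q))
        (Icc 0 1) r := by
    intro p q hp hq r hr
    have h1 : HasDerivWithinAt (fun r : ℝ => q + r • (p - q)) (p - q) (Icc 0 1) r := by
      simpa using ((hasDerivWithinAt_id r (Icc 0 1)).smul_const (p - q)).const_add q
    exact (hf _ (hseg hp hq r hr)).comp_hasDerivWithinAt r h1 (hseg hp hq)
  have key := norm_image_sub_le_of_norm_deriv_le_segment_01'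
    (f := fun r : ℝ => f (q₂ + r • (q₁ - q₂)) - f (q₄ + r • (q₃ - q₄)))
    (C := L₁ * ‖q₁ - q₂ - (q₃ - q₄)‖ + L₂ * (max ‖q₁ - q₃‖ ‖q₂ - q₄‖ * ‖q₃ - q₄‖))
    (fun r hr => (hder h₁ h₂ r hr).sub (hder h₃ h₄ r hr)) fun r hr => ?_
  · simpa only [one_smul, zero_smul, add_zero, add_sub_cancel, sub_sub_sub_comm] using key
  · have hr' := Ico_subset_Icc_self hr
    set A := q₂ + r • (q₁ - q₂) with hA
    set B := q₄ + r • (q₃ - q₄) with hB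
    have hAS : A ∈ S := hseg h₁ h₂ r hr'
    have hBS : B ∈ S := hseg h₃ h₄ r hr'
    have hAB : ‖A - B‖ ≤ max ‖q₁ - q₃‖ ‖q₂ - q₄‖ := by
      have e : A - B = r • (q₁ - q₃) + (1 - r) • (q₂ - q₄) := by rw [hA, hB]; module
      have hr0 := hr'.1
      have hr1 : 0 ≤ 1 - r := by linarith [hr'.2]
      calc ‖A - B‖ ≤ r * ‖q₁ - q₃‖ + (1 - r) * ‖q₂ - q₄‖ := by
            rw [e]
            refine (norm_add_le _ _).trans (le_of_eq ?_)
            rw [norm_smul, norm_smul, Real.norm_of_nonneg hr0, Real.norm_of_nonneg hr1]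
        _ ≤ r * max ‖q₁ - q₃‖ ‖q₂ - q₄‖ + (1 - r) * max ‖q₁ - q₃‖ ‖q₂ - q₄‖ :=
            add_le_add (mul_le_mul_of_nonneg_left (le_max_left _ _) hr0)
              (mul_le_mul_of_nonneg_left (le_max_right _ _) hr1)
        _ = _ := by ring
    have e : f' A (q₁ - q₂) - f' B (q₃ - q₄)
        = f' A (q₁ - q₂ - (q₃ - q₄)) + (f' A - f' B) (q₃ - q₄) := by
      rw [map_sub (f' A) (q₁ - q₂), sub_apply]; abel
    rw [e]
    refine (norm_add_le _ _).trans (add_le_add ?_ ?_)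
    · exact (f' A).le_of_opNorm_le (hb A hAS) _
    · refine ((f' A - f' B).le_of_opNorm_le (hlip A hAS B hBS) _).trans ?_
      rw [mul_assoc]
      gcongr

variable {V : Type*} [NormedAddCommGroup V] [NormedSpace ℝ V]

/-- The increments of `σ` that enter the estimates for the Volterra equation on `[0, T]`, all with
the same constant `L`. In the last one, the increment in the first time variable is raised to the
power `κ` in front of the product of two increments in the other variables. -/
structure IncrementBounds (T κ L : ℝ) (σ : ℝ × ℝ × V → F) : Prop where
  nonneg : 0 ≤ L
  lip : ∀ p ∈ Icc 0 T ×ˢ Icc 0 T ×ˢ (univ : Set V), ∀ q ∈ Icc 0 T ×ˢ Icc 0 T ×ˢ (univ : Set V),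
    ‖σ p - σ q‖ ≤ L * ‖p - q‖
  lip_sub : ∀ s ∈ Icc 0 T, ∀ t ∈ Icc 0 T, ∀ q ∈ Icc 0 T ×ˢ (univ : Set V),
    ∀ q' ∈ Icc 0 T ×ˢ (univ : Set V),
    ‖σ (t, q) - σ (s, q) - (σ (t, q') - σ (s, q'))‖ ≤ L * |t - s| * ‖q - q'‖
  four : ∀ t ∈ Icc 0 T, ∀ q₁ ∈ Icc 0 T ×ˢ (univ : Set V), ∀ q₂ ∈ Icc 0 T ×ˢ (univ : Set V),
    ∀ q₃ ∈ Icc 0 T ×ˢ (univ : Set V), ∀ q₄ ∈ Icc 0 T ×ˢ (univ : Set V),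
    ‖σ (t, q₁) - σ (t, q₂) - (σ (t, q₃) - σ (t, q₄))‖
      ≤ L * ‖q₁ - q₂ - (q₃ - q₄)‖ + L * (max ‖q₁ - q₃‖ ‖q₂ - q₄‖ * ‖q₃ - q₄‖)
  eight : ∀ s ∈ Icc 0 T, ∀ t ∈ Icc 0 T,
    ∀ q₁ ∈ Icc 0 T ×ˢ (univ : Set V), ∀ q₂ ∈ Icc 0 T ×ˢ (univ : Set V),
    ∀ q₃ ∈ Icc 0 T ×ˢ (univ : Set V), ∀ q₄ ∈ Icc 0 T ×ˢ (univ : Set V),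
    ‖(σ (t, q₁) - σ (s, q₁)) - (σ (t, q₂) - σ (s, q₂))
        - ((σ (t, q₃) - σ (s, q₃)) - (σ (t, q₄) - σ (s, q₄)))‖
      ≤ L * |t - s| * ‖q₁ - q₂ - (q₃ - q₄)‖
        + L * |t - s| ^ κ * (max ‖q₁ - q₃‖ ‖q₂ - q₄‖ * ‖q₃ - q₄‖)

lemma norm_comp_inr_le (A : ℝ × E →L[ℝ] F) :
    ‖A.comp (ContinuousLinearMap.inr ℝ ℝ E)‖ ≤ ‖A‖ := by
  refine ContinuousLinearMap.opNorm_le_bound _ (norm_nonneg _) fun v => ?_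
  refine (A.le_opNorm _).trans (le_of_eq ?_)
  simp [Prod.norm_def]

lemma MemCkbHolder.exists_incrementBounds {T κ : ℝ} (hT : 0 < T) {σ : ℝ × ℝ × V → F}
    (hσ : MemCkbHolder 2 κ (Icc 0 T ×ˢ Icc 0 T ×ˢ univ) σ) :
    ∃ L, IncrementBounds T κ L σ := by
  set Q : Set (ℝ × V) := Icc 0 T ×ˢ univ with hQ
  set U : Set (ℝ × ℝ × V) := Icc 0 T ×ˢ Q with hU
  have hQc : Convex ℝ Q := (convex_Icc 0 T).prod convex_univ
  have hUc : Convex ℝ U := (convex_Icc 0 T).prod hQc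
  have hud : UniqueDiffOn ℝ U :=
    (uniqueDiffOn_Icc hT).prod ((uniqueDiffOn_Icc hT).prod uniqueDiffOn_univ)
  set D := fderivWithin ℝ σ U with hD
  set D₂ := fderivWithin ℝ D U with hD₂
  have hσd : ∀ p ∈ U, HasFDerivWithinAt σ (D p) U p := fun p hp =>
    (hσ.contDiffOn.differentiableOn (by norm_num) p hp).hasFDerivWithinAt
  have hDd : ∀ p ∈ U, HasFDerivWithinAt D (D₂ p) U p := fun p hp =>
    ((hσ.contDiffOn.fderivWithin hud (m := 1) (by norm_num)).differentiableOn (by norm_num) p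
      hp).hasFDerivWithinAt
  obtain ⟨C₁, hC₁⟩ := hσ.bounded 1 le_rfl one_le_two
  obtain ⟨C₂, hC₂⟩ := hσ.bounded 2 one_le_two le_rfl
  obtain ⟨C₃, hC₃⟩ := hσ.holder
  set L := |C₁| + |C₂| + |C₃| with hL
  have hL1 : C₁ ≤ L := by linarith [le_abs_self C₁, abs_nonneg C₂, abs_nonneg C₃]
  have hL2 : C₂ ≤ L := by linarith [le_abs_self C₂, abs_nonneg C₁, abs_nonneg C₃]
  have hL3 : C₃ ≤ L := by linarith [le_abs_self C₃, abs_nonneg C₁, abs_nonneg C₂]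
  have hL0 : 0 ≤ L := by positivity
  have hD1 : ∀ p ∈ U, ‖D p‖ ≤ L := fun p hp => by
    rw [hD, ← norm_iteratedFDerivWithin_one σ (hud p hp)]
    exact (hC₁ p hp).trans hL1
  have htwo : ∀ p ∈ U, ∀ v w, D₂ p v w = iteratedFDerivWithin ℝ 2 σ U p ![v, w] :=
    fun p hp v w => (iteratedFDerivWithin_two_apply' σ hud hp v w).symm
  have hD2 : ∀ p ∈ U, ‖D₂ p‖ ≤ L := fun p hp => by
    refine ContinuousLinearMap.opNorm_le_bound₂ _ hL0 fun v w => ?_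
    rw [htwo p hp]
    refine ((iteratedFDerivWithin ℝ 2 σ U p).le_of_opNorm_le ((hC₂ p hp).trans hL2) _).trans ?_
    simp [Fin.prod_univ_two, mul_assoc]
  have hD3 : ∀ p ∈ U, ∀ q ∈ U, ‖D₂ p - D₂ q‖ ≤ L * ‖p - q‖ ^ κ := fun p hp q hq => by
    have h0 : 0 ≤ L * ‖p - q‖ ^ κ := mul_nonneg hL0 (Real.rpow_nonneg (norm_nonneg _) _)
    refine ContinuousLinearMap.opNorm_le_bound₂ _ h0 fun v w => ?_
    have e : (D₂ p - D₂ q) v w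
        = (iteratedFDerivWithin ℝ 2 σ U p - iteratedFDerivWithin ℝ 2 σ U q) ![v, w] := by
      rw [sub_apply, sub_apply, htwo p hp, htwo q hq]; rfl
    rw [e]
    refine (ContinuousMultilinearMap.le_of_opNorm_le ((hC₃ p hp q hq).trans
      (mul_le_mul_of_nonneg_right hL3 (Real.rpow_nonneg (norm_nonneg _) _))) _).trans ?_
    simp [Fin.prod_univ_two, mul_assoc]
  have hDlip : ∀ p ∈ U, ∀ q ∈ U, ‖D p - D q‖ ≤ L * ‖p - q‖ := fun p hp q hq =>
    hUc.norm_image_sub_le_of_norm_hasFDerivWithin_le hDd hD2 hq hp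
  have hmaps : ∀ t ∈ Icc 0 T, MapsTo (fun q : ℝ × V => (t, q)) Q U := fun t ht q hq => ⟨ht, hq⟩
  have hmk : ∀ (t : ℝ) (q : ℝ × V), HasFDerivWithinAt (fun q : ℝ × V => (t, q))
      (ContinuousLinearMap.inr ℝ ℝ (ℝ × V)) Q q := fun t q =>
    (hasFDerivAt_prodMk_right t q).hasFDerivWithinAt
  have hnorm : ∀ (t : ℝ) (q q' : ℝ × V), ‖(t, q) - (t, q')‖ = ‖q - q'‖ := fun t q q' => by
    simp [Prod.norm_def]
  have hnorm' : ∀ (s t : ℝ) (q : ℝ × V), ‖(t, q) - (s, q)‖ = |t - s| := fun s t q => by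
    simp [Prod.norm_def]
  -- derivative in the last two variables of `σ (t, ·) - σ (s, ·)` and of its derivative
  have hFd : ∀ s ∈ Icc 0 T, ∀ t ∈ Icc 0 T, ∀ q ∈ Q,
      HasFDerivWithinAt (fun q => σ (t, q) - σ (s, q))
        ((D (t, q) - D (s, q)).comp (ContinuousLinearMap.inr ℝ ℝ (ℝ × V))) Q q :=
    fun s hs t ht q hq =>
      ((hσd (t, q) ⟨ht, hq⟩).comp q (hmk t q) (hmaps t ht)).sub
        ((hσd (s, q) ⟨hs, hq⟩).comp q (hmk s q) (hmaps s hs))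
  have hFb : ∀ s ∈ Icc 0 T, ∀ t ∈ Icc 0 T, ∀ q ∈ Q,
      ‖(D (t, q) - D (s, q)).comp (ContinuousLinearMap.inr ℝ ℝ (ℝ × V))‖ ≤ L * |t - s| :=
    fun s hs t ht q hq => by
      rw [← hnorm' s t q]
      exact (norm_comp_inr_le _).trans (hDlip (t, q) ⟨ht, hq⟩ (s, q) ⟨hs, hq⟩)
  have hFlip : ∀ s ∈ Icc 0 T, ∀ t ∈ Icc 0 T, ∀ q ∈ Q, ∀ q' ∈ Q,
      ‖(D (t, q) - D (s, q)) - (D (t, q') - D (s, q'))‖ ≤ L * |t - s| ^ κ * ‖q - q'‖ := by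
    intro s hs t ht q hq q' hq'
    refine hQc.norm_image_sub_le_of_norm_hasFDerivWithin_le
      (f := fun q => D (t, q) - D (s, q))
      (f' := fun q => (D₂ (t, q) - D₂ (s, q)).comp (ContinuousLinearMap.inr ℝ ℝ (ℝ × V)))
      (fun q hq => ((hDd (t, q) ⟨ht, hq⟩).comp q (hmk t q) (hmaps t ht)).sub
        ((hDd (s, q) ⟨hs, hq⟩).comp q (hmk s q) (hmaps s hs))) (fun q hq => ?_) hq' hq
    rw [← hnorm' s t q]
    exact (norm_comp_inr_le _).trans (hD3 (t, q) ⟨ht, hq⟩ (s, q) ⟨hs, hq⟩)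
  refine ⟨L, hL0, ?_, ?_, ?_, ?_⟩
  · exact fun p hp q hq => hUc.norm_image_sub_le_of_norm_hasFDerivWithin_le hσd hD1 hq hp
  · exact fun s hs t ht q hq q' hq' => hQc.norm_image_sub_le_of_norm_hasFDerivWithin_le
      (f := fun q => σ (t, q) - σ (s, q)) (hFd s hs t ht) (hFb s hs t ht) hq' hq
  · intro t ht q₁ h₁ q₂ h₂ q₃ h₃ q₄ h₄
    refine norm_four_point_le (f := fun q => σ (t, q))
      (f' := fun q => (D (t, q)).comp (ContinuousLinearMap.inr ℝ ℝ (ℝ × V))) hQc hL0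
      (fun q hq => (hσd (t, q) ⟨ht, hq⟩).comp q (hmk t q) (hmaps t ht))
      (fun q hq => (norm_comp_inr_le _).trans (hD1 _ ⟨ht, hq⟩)) (fun q hq q' hq' => ?_) h₁ h₂ h₃ h₄
    rw [← ContinuousLinearMap.sub_comp, ← hnorm t]
    exact (norm_comp_inr_le _).trans (hDlip _ ⟨ht, hq⟩ _ ⟨ht, hq'⟩)
  · intro s hs t ht q₁ h₁ q₂ h₂ q₃ h₃ q₄ h₄
    refine norm_four_point_le (f := fun q => σ (t, q) - σ (s, q)) hQc
      (mul_nonneg hL0 (Real.rpow_nonneg (abs_nonneg _) _)) (hFd s hs t ht) (hFb s hs t ht)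
      (fun q hq q' hq' => ?_) h₁ h₂ h₃ h₄
    rw [← ContinuousLinearMap.sub_comp]
    exact (norm_comp_inr_le _).trans (hFlip s hs t ht q hq q' hq')

end CoefficientEstimates

/-! ### Weighted Hölder norms on blocks -/

section Blocks

variable {G : Type*} [NormedAddCommGroup G]

/-- `f` is `β`-Hölder on each block `[kε, (k + 1)ε] ∩ [0, T]`, with constant `c 2^k` on the `k`-th
one. The weights `2^k` play the part of the factor `exp (λ t)` in Bielecki's norm: a sum over the
blocks before the `k`-th one is dominated by its last term. -/
def BlockHolder (T ε β c : ℝ) (f : ℝ → G) : Prop :=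
  ∀ (k : ℕ) (s t : ℝ), k * ε ≤ s → s ≤ t → t ≤ (k + 1) * ε → t ≤ T →
    ‖f t - f s‖ ≤ c * 2 ^ k * (t - s) ^ β

lemma BlockHolder.mono_const {T ε β c c' : ℝ} {f : ℝ → G} (hf : BlockHolder T ε β c f)
    (h : c ≤ c') : BlockHolder T ε β c' f := by
  intro k s t h1 h2 h3 h4
  have := Real.rpow_nonneg (sub_nonneg.2 h2) β
  exact (hf k s t h1 h2 h3 h4).trans (by gcongr)

lemma sub_le_one_of_mem_block {ε s t : ℝ} {k : ℕ} (hε1 : ε ≤ 1) (h1 : k * ε ≤ s)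
    (h3 : t ≤ (k + 1) * ε) : t - s ≤ 1 := by linarith

lemma BlockHolder.mono_exponent {T ε β β' c : ℝ} {f : ℝ → G} (hf : BlockHolder T ε β c f)
    (hε1 : ε ≤ 1) (hc : 0 ≤ c) (hβ' : 0 < β') (h : β' ≤ β) : BlockHolder T ε β' c f := by
  intro k s t h1 h2 h3 h4
  refine (hf k s t h1 h2 h3 h4).trans ?_
  have := Real.rpow_le_rpow_of_exponent_ge' (sub_nonneg.2 h2)
    (sub_le_one_of_mem_block hε1 h1 h3) hβ'.le h
  gcongr

lemma BlockHolder.norm_sub_zero_le {T ε β c : ℝ} {f : ℝ → G} (hf : BlockHolder T ε β c f)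
    (hε : 0 < ε) (hβ : 0 < β) (hc : 0 ≤ c) {k : ℕ} {t : ℝ} (h1 : k * ε ≤ t)
    (h2 : t ≤ (k + 1) * ε) (h3 : t ≤ T) : ‖f t - f 0‖ ≤ 2 * c * 2 ^ k * ε ^ β := by
  have step : ∀ (k : ℕ) (s t : ℝ), k * ε ≤ s → s ≤ t → t ≤ (k + 1) * ε → t ≤ T →
      ‖f t - f s‖ ≤ c * 2 ^ k * ε ^ β := fun k s t h1 h2 h3 h4 => by
    refine (hf k s t h1 h2 h3 h4).trans ?_
    have := Real.rpow_le_rpow (sub_nonneg.2 h2) (by linarith : t - s ≤ ε) hβ.le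
    gcongr
  have hεβ : 0 ≤ c * ε ^ β := mul_nonneg hc (Real.rpow_nonneg hε.le _)
  -- at the nodes, the contributions of the past blocks form a geometric sum
  have node : ∀ k : ℕ, k * ε ≤ T → ‖f (k * ε) - f 0‖ ≤ c * (2 ^ k - 1) * ε ^ β := by
    intro k
    induction k with
    | zero => simp
    | succ k ih =>
      intro hk
      push_cast at hk ⊢
      have h := step k (k * ε) ((k + 1) * ε) le_rfl (by linarith) le_rfl hk
      have h' := ih (by linarith)
      calc ‖f ((k + 1) * ε) - f 0‖ ≤ ‖f ((k + 1) * ε) - f (k * ε)‖ + ‖f (k * ε) - f 0‖ :=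
            norm_sub_le_norm_sub_add_norm_sub _ _ _
        _ ≤ c * 2 ^ k * ε ^ β + c * (2 ^ k - 1) * ε ^ β := add_le_add h h'
        _ = c * (2 ^ (k + 1) - 1) * ε ^ β := by ring
  have h4 := step k (k * ε) t le_rfl h1 h2 h3
  have h5 := node k (h1.trans h3)
  have h6 := norm_sub_le_norm_sub_add_norm_sub (f t) (f (k * ε)) (f 0)
  linarith

lemma BlockHolder.norm_sub_zero_le_total {T ε β c : ℝ} {f : ℝ → G} (hf : BlockHolder T ε β c f)
    (hε : 0 < ε) (hβ : 0 < β) (hc : 0 ≤ c) {t : ℝ} (ht : t ∈ Icc 0 T) :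
    ‖f t - f 0‖ ≤ c * (2 * 2 ^ ⌊T / ε⌋₊ * ε ^ β) := by
  have h1 := hf.norm_sub_zero_le hε hβ hc (k := ⌊t / ε⌋₊)
    ((le_div_iff₀ hε).1 (Nat.floor_le (div_nonneg ht.1 hε.le)))
    ((div_le_iff₀ hε).1 (Nat.lt_floor_add_one _).le) ht.2
  have h2 : (2 : ℝ) ^ ⌊t / ε⌋₊ ≤ 2 ^ ⌊T / ε⌋₊ :=
    pow_le_pow_right₀ one_le_two (Nat.floor_le_floor (div_le_div_of_nonneg_right ht.2 hε.le))
  have h3 := Real.rpow_nonneg hε.le β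
  calc ‖f t - f 0‖ ≤ 2 * c * 2 ^ ⌊t / ε⌋₊ * ε ^ β := h1
    _ ≤ 2 * c * 2 ^ ⌊T / ε⌋₊ * ε ^ β := by gcongr
    _ = _ := by ring

/-- Going through the nodes between two times, a block Hölder function is Hölder on `[0, T]`. -/
lemma BlockHolder.holderBound {T ε β c : ℝ} {f : ℝ → G} (hf : BlockHolder T ε β c f)
    (hε : 0 < ε) (hβ : 0 < β) (hc : 0 ≤ c) :
    HolderBound 0 T β ((⌊T / ε⌋₊ + 1) * (c * 2 ^ ⌊T / ε⌋₊)) f := by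
  have key : ∀ (k : ℕ) (s t : ℝ), 0 ≤ s → s ≤ t → t ≤ (k + 1) * ε → t ≤ T →
      ‖f t - f s‖ ≤ (k + 1) * (c * 2 ^ k) * (t - s) ^ β := by
    intro k
    induction k with
    | zero =>
      intro s t h1 h2 h3 h4
      simpa using hf 0 s t (by simpa using h1) h2 (by simpa using h3) h4
    | succ k ih =>
      intro s t h1 h2 h3 h4
      have hr := Real.rpow_nonneg (sub_nonneg.2 h2) β
      have hpow : c * 2 ^ k ≤ c * 2 ^ (k + 1) :=
        mul_le_mul_of_nonneg_left (pow_le_pow_right₀ one_le_two (Nat.le_succ k)) hc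
      have hck : 0 ≤ c * 2 ^ (k + 1) := by positivity
      have hk : (0 : ℝ) ≤ k := Nat.cast_nonneg k
      push_cast at h3 ⊢
      rcases le_total t ((k + 1) * ε) with h | h
      · refine (ih s t h1 h2 h h4).trans (mul_le_mul_of_nonneg_right ?_ hr)
        nlinarith
      rcases le_total ((k + 1) * ε) s with h' | h'
      · refine (hf (k + 1) s t (by push_cast; exact h') h2 (by push_cast; exact h3) h4).trans
          (mul_le_mul_of_nonneg_right ?_ hr)
        nlinarith
      have e1 := hf (k + 1) ((k + 1) * ε) t (by push_cast; exact le_rfl) h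
        (by push_cast; exact h3) h4
      have e2 := ih s ((k + 1) * ε) h1 h' le_rfl (h.trans h4)
      have r1 : (t - (k + 1) * ε) ^ β ≤ (t - s) ^ β :=
        Real.rpow_le_rpow (by linarith) (by linarith) hβ.le
      have r2 : ((k + 1) * ε - s) ^ β ≤ (t - s) ^ β :=
        Real.rpow_le_rpow (by linarith) (by linarith) hβ.le
      calc ‖f t - f s‖ ≤ ‖f t - f ((k + 1) * ε)‖ + ‖f ((k + 1) * ε) - f s‖ :=
            norm_sub_le_norm_sub_add_norm_sub _ _ _
        _ ≤ c * 2 ^ (k + 1) * (t - s) ^ β + (k + 1) * (c * 2 ^ (k + 1)) * (t - s) ^ β := by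
            refine add_le_add (e1.trans (mul_le_mul_of_nonneg_left r1 hck)) (e2.trans ?_)
            refine mul_le_mul ?_ r2 (Real.rpow_nonneg (by linarith) _) (by positivity)
            gcongr
        _ = _ := by ring
  intro s t h1 h2 h3
  exact key _ s t h1 h2 (h3.trans ((div_le_iff₀ hε).1 (Nat.lt_floor_add_one _).le)) h3

lemma HolderBound.blockHolder {T ε β c : ℝ} {f : ℝ → G} (hf : HolderBound 0 T β c f)
    (hε : 0 < ε) (hc : 0 ≤ c) : BlockHolder T ε β c f := by
  intro k s t h1 h2 h3 h4
  refine (hf s t ((by positivity : (0 : ℝ) ≤ k * ε).trans h1) h2 h4).trans ?_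
  have : c ≤ c * 2 ^ k := le_mul_of_one_le_right hc (one_le_pow₀ one_le_two)
  exact mul_le_mul_of_nonneg_right this (Real.rpow_nonneg (sub_nonneg.2 h2) _)

lemma exists_small_block {β B : ℝ} (hβ : 0 < β) (hB : 0 ≤ B) :
    ∃ ε : ℝ, 0 < ε ∧ ε ≤ 1 ∧ B * ε ^ β ≤ 1 / 2 := by
  have h0 : 0 < (2 * (B + 1))⁻¹ := by positivity
  refine ⟨(2 * (B + 1))⁻¹ ^ (1 / β), Real.rpow_pos_of_pos h0 _,
    Real.rpow_le_one h0.le (inv_le_one_of_one_le₀ (by linarith)) (by positivity), ?_⟩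
  rw [← Real.rpow_mul h0.le, one_div_mul_cancel hβ.ne', Real.rpow_one, ← div_eq_mul_inv,
    div_le_iff₀ (by positivity)]
  linarith

variable {V W : Type*} [NormedAddCommGroup V] [NormedSpace ℝ V]
  [NormedAddCommGroup W] [NormedSpace ℝ W]

/-- The part of the constant that involves `c` gains the factor `ε ^ β`: the increments of `z` over
past blocks sum up to `O(c 2^k ε^β)`, and the Young–Loève remainder is of order `β + γ`. -/
lemma IsYoungPath.blockHolder {T ε β γ c A X : ℝ} {z : ℝ → W →L[ℝ] V} {x : ℝ → W} {I : ℝ → V}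
    (hI : IsYoungPath 0 T z x I) (hβ : 0 < β) (hγ : 0 < γ) (hβγ : 1 < β + γ) (hε : 0 < ε)
    (hc : 0 ≤ c) (hX : 0 ≤ X) (hz : BlockHolder T ε β c z) (hz0 : ‖z 0‖ ≤ A)
    (hx : HolderBound 0 T γ X x) :
    BlockHolder T ε γ (X * (A + (2 + sewConst (β + γ)) * c * ε ^ β)) I := by
  intro k s t h1 h2 h3 h4
  have hkε : 0 ≤ k * ε := by positivity
  have hs0 : 0 ≤ s := hkε.trans h1
  have hA : 0 ≤ A := (norm_nonneg _).trans hz0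
  have hK := (sewConst_pos hβγ).le
  have hck : 0 ≤ c * 2 ^ k := by positivity
  have hts : 0 ≤ t - s := sub_nonneg.2 h2
  have hr := Real.rpow_nonneg hts γ
  have hεβ := Real.rpow_nonneg hε.le β
  have hloeve := (hI.mono hs0 h4).norm_sub_le hβ hγ hβγ hck hX
    (fun u v hu huv hv => hz k u v (h1.trans hu) huv (hv.trans h3) (hv.trans h4))
    (fun u v hu huv hv => hx u v (hs0.trans hu) huv (hv.trans h4)) le_rfl h2 le_rfl
  have hzs : ‖z s‖ ≤ A + 2 * c * 2 ^ k * ε ^ β := by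
    have := hz.norm_sub_zero_le hε hβ hc h1 (h2.trans h3) (h2.trans h4)
    have h := norm_add_le (z s - z 0) (z 0)
    rw [sub_add_cancel] at h
    linarith
  have hone : (1 : ℝ) ≤ 2 ^ k := one_le_pow₀ one_le_two
  have hfirst : ‖z s (x t - x s)‖ ≤ (A + 2 * c * 2 ^ k * ε ^ β) * (X * (t - s) ^ γ) :=
    ((z s).le_opNorm _).trans (mul_le_mul hzs (hx s t hs0 h2 h4) (norm_nonneg _) (by positivity))
  have hrem : (t - s) ^ (β + γ) ≤ ε ^ β * (t - s) ^ γ := by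
    rw [Real.rpow_add_of_nonneg hts hβ.le hγ.le]
    exact mul_le_mul_of_nonneg_right (Real.rpow_le_rpow hts (by linarith) hβ.le) hr
  calc ‖I t - I s‖ = ‖(I t - I s - z s (x t - x s)) + z s (x t - x s)‖ := by rw [sub_add_cancel]
    _ ≤ sewConst (β + γ) * (c * 2 ^ k * X) * (ε ^ β * (t - s) ^ γ)
        + (A + 2 * c * 2 ^ k * ε ^ β) * (X * (t - s) ^ γ) := by
        refine (norm_add_le _ _).trans (add_le_add (hloeve.trans ?_) hfirst)
        gcongr
    _ = (A + (2 + sewConst (β + γ)) * c * ε ^ β * 2 ^ k) * (X * (t - s) ^ γ) := by ring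
    _ ≤ (A * 2 ^ k + (2 + sewConst (β + γ)) * c * ε ^ β * 2 ^ k) * (X * (t - s) ^ γ) := by
        gcongr
        exact le_mul_of_one_le_right hA hone
    _ = _ := by ring

/-- Block Hölder estimate for the path `t ↦ ∫₀ᵗ z(t, u) dx_u`: its increment over `[s, t]` is
`∫ₛᵗ z(t, u) dx_u + ∫₀ˢ (z(t, u) - z(s, u)) dx_u`. -/
lemma blockHolder_volterra {T ε β β' γ c A A' X : ℝ} {z : ℝ → ℝ → W →L[ℝ] V} {x : ℝ → W}
    {I : ℝ → ℝ → V} (hβ : 0 < β) (hγ : 0 < γ) (hβγ : 1 < β + γ) (hβ' : 0 < β') (hβ'γ : β' ≤ γ)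
    (hε : 0 < ε) (hε1 : ε ≤ 1) (hc : 0 ≤ c) (hX : 0 ≤ X) (hA : 0 ≤ A) (hA' : 0 ≤ A')
    (hx : HolderBound 0 T γ X x) (hI : ∀ t ∈ Icc 0 T, IsYoungPath 0 T (z t) x (I t))
    (hI0 : ∀ t ∈ Icc 0 T, I t 0 = 0) (hz : ∀ t ∈ Icc 0 T, BlockHolder T ε β c (z t))
    (hz0 : ∀ t ∈ Icc 0 T, ‖z t 0‖ ≤ A)
    (hzz : ∀ s ∈ Icc 0 T, ∀ t ∈ Icc 0 T, s ≤ t → t - s ≤ 1 →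
      BlockHolder T ε β (c * (t - s) ^ β') fun u => z t u - z s u)
    (hzz0 : ∀ s ∈ Icc 0 T, ∀ t ∈ Icc 0 T, s ≤ t → t - s ≤ 1 →
      ‖z t 0 - z s 0‖ ≤ A' * (t - s) ^ β') :
    BlockHolder T ε β' (X * (A + 2 * A') + 3 * X * (2 + sewConst (β + γ)) * c * ε ^ β)
      fun t => I t t := by
  intro k s t h1 h2 h3 h4
  have hs : s ∈ Icc 0 T := ⟨(by positivity : (0 : ℝ) ≤ k * ε).trans h1, h2.trans h4⟩
  have ht : t ∈ Icc 0 T := ⟨hs.1.trans h2, h4⟩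
  have hts := sub_le_one_of_mem_block hε1 h1 h3
  have hts0 := sub_nonneg.2 h2
  have hr := Real.rpow_nonneg hts0 β'
  have hεβ := Real.rpow_nonneg hε.le β
  have hεγ := Real.rpow_le_one hε.le hε1 hγ.le
  have hK := (sewConst_pos hβγ).le
  have e1 := (hI t ht).blockHolder hβ hγ hβγ hε hc hX (hz t ht) (hz0 t ht) hx k s t h1 h2 h3 h4
  have e2 := (((hI t ht).sub (hI s hs)).blockHolder hβ hγ hβγ hε (by positivity) hX
    (hzz s hs t ht h2 hts) (hzz0 s hs t ht h2 hts) hx).norm_sub_zero_le hε hγ (by positivity)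
    h1 (h2.trans h3) hs.2
  rw [hI0 t ht, hI0 s hs, sub_self, sub_zero] at e2
  have e3 : (t - s) ^ γ ≤ (t - s) ^ β' :=
    Real.rpow_le_rpow_of_exponent_ge' hts0 hts hβ'.le hβ'γ
  calc ‖I t t - I s s‖ ≤ ‖I t t - I t s‖ + ‖I t s - I s s‖ :=
        norm_sub_le_norm_sub_add_norm_sub _ _ _
    _ ≤ X * (A + (2 + sewConst (β + γ)) * c * ε ^ β) * 2 ^ k * (t - s) ^ β'
        + 2 * (X * (A' * (t - s) ^ β' + (2 + sewConst (β + γ)) * (c * (t - s) ^ β') * ε ^ β))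
          * 2 ^ k * 1 := by
        refine add_le_add (e1.trans ?_) (e2.trans ?_)
        · gcongr
        · gcongr
    _ = _ := by ring

end Blocks

/-! ### The Volterra equation driven by a Hölder path -/

section Volterra

variable {V W : Type*} [NormedAddCommGroup V] [NormedSpace ℝ V]
  [NormedAddCommGroup W] [NormedSpace ℝ W]

open Classical in
/-- The Young primitive of `z` against `x` on `[0, T]` that vanishes at `0`, and `0` if there is
none. -/
noncomputable def youngPrimitive (T : ℝ) (z : ℝ → W →L[ℝ] V) (x : ℝ → W) : ℝ → V :=
  if h : ∃ I : ℝ → V, I 0 = 0 ∧ IsYoungPath 0 T z x I then h.choose else 0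

/-- The map whose fixed points are the solutions of the Volterra equation. -/
noncomputable def picardMap (T : ℝ) (σ : ℝ × ℝ × V → W →L[ℝ] V) (a : V) (x : ℝ → W) (y : ℝ → V)
    (t : ℝ) : V :=
  a + youngPrimitive T (fun u => σ (t, u, y u)) x t

lemma youngPrimitive_spec {T : ℝ} {z : ℝ → W →L[ℝ] V} {x : ℝ → W}
    (h : ∃ I : ℝ → V, I 0 = 0 ∧ IsYoungPath 0 T z x I) :
    youngPrimitive T z x 0 = 0 ∧ IsYoungPath 0 T z x (youngPrimitive T z x) := by
  unfold youngPrimitive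
  rw [dif_pos h]
  exact h.choose_spec

lemma HolderBound.comp_coeff {T κ L γ c : ℝ} {σ : ℝ × ℝ × V → W →L[ℝ] V} {y : ℝ → V}
    (hσ : IncrementBounds T κ L σ) (hγ : 0 < γ) (hγ1 : γ < 1)
    (hy : HolderBound 0 T γ c y) {t : ℝ} (ht : t ∈ Icc 0 T) :
    HolderBound 0 T γ (L * (T ^ (1 - γ) + |c|)) fun u => σ (t, u, y u) := by
  intro u v hu huv hv
  have hr0 : 0 ≤ v - u := sub_nonneg.2 huv
  have hr := Real.rpow_nonneg hr0 γ
  have hT : 0 ≤ T := hu.trans (huv.trans hv)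
  refine (hσ.lip (t, v, y v) ⟨ht, ⟨hu.trans huv, hv⟩, mem_univ _⟩ (t, u, y u)
    ⟨ht, ⟨hu, huv.trans hv⟩, mem_univ _⟩).trans ?_
  rw [mul_assoc]
  refine mul_le_mul_of_nonneg_left ?_ hσ.nonneg
  have e1 : v - u ≤ T ^ (1 - γ) * (v - u) ^ γ := by
    calc v - u = (v - u) ^ (1 - γ) * (v - u) ^ γ := by
          rw [← Real.rpow_add_of_nonneg hr0 (by linarith) hγ.le, sub_add_cancel, Real.rpow_one]
      _ ≤ _ := mul_le_mul_of_nonneg_right (Real.rpow_le_rpow hr0 (by linarith) (by linarith)) hr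
  have e2 : ‖y v - y u‖ ≤ |c| * (v - u) ^ γ :=
    (hy u v hu huv hv).trans (mul_le_mul_of_nonneg_right (le_abs_self c) hr)
  have hTγ := mul_nonneg (Real.rpow_nonneg hT (1 - γ)) hr
  have hcγ := mul_nonneg (abs_nonneg c) hr
  simp only [Prod.mk_sub_mk, sub_self, Prod.norm_def, norm_zero, Real.norm_of_nonneg hr0]
  refine max_le (by positivity) (max_le ?_ ?_) <;> linarith

lemma youngPrimitive_coeff [CompleteSpace W] [ProperSpace V] {T κ L γ c X : ℝ}
    {σ : ℝ × ℝ × V → W →L[ℝ] V} {x : ℝ → W} {y : ℝ → V} (hσ : IncrementBounds T κ L σ)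
    (hγ : 1 / 2 < γ) (hγ1 : γ < 1) (hX : 0 ≤ X) (hx : HolderBound 0 T γ X x)
    (hy : HolderBound 0 T γ c y) {t : ℝ} (ht : t ∈ Icc 0 T) :
    youngPrimitive T (fun u => σ (t, u, y u)) x 0 = 0 ∧
      IsYoungPath 0 T (fun u => σ (t, u, y u)) x
        (youngPrimitive T (fun u => σ (t, u, y u)) x) := by
  have hT : 0 ≤ T := ht.1.trans ht.2
  have hγ0 : 0 < γ := by linarith
  exact youngPrimitive_spec (exists_isYoungPath hT hγ0 hγ0 (by linarith)
    (mul_nonneg hσ.nonneg (add_nonneg (Real.rpow_nonneg hT _) (abs_nonneg _))) hX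
    (hy.comp_coeff hσ hγ0 hγ1 ht) hx)

/-- Solutions of the Volterra equation in `C^γ` are the fixed points of `picardMap`. -/
lemma isSolution_iff [CompleteSpace W] [ProperSpace V] {T κ L γ c X : ℝ}
    {σ : ℝ × ℝ × V → W →L[ℝ] V} {x : ℝ → W} {y : ℝ → V} {a : V} (hσ : IncrementBounds T κ L σ)
    (hγ : 1 / 2 < γ) (hγ1 : γ < 1) (hX : 0 ≤ X) (hx : HolderBound 0 T γ X x)
    (hy : HolderBound 0 T γ c y) :
    IsSolution T σ a x y ↔ ∀ t ∈ Icc 0 T, y t = picardMap T σ a x y t := by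
  have hγ0 : 0 < γ := by linarith
  refine forall₂_congr fun t ht => ?_
  have hT : 0 ≤ T := ht.1.trans ht.2
  obtain ⟨h0, hI⟩ := youngPrimitive_coeff hσ hγ hγ1 hX hx hy ht
  constructor
  · rintro ⟨J, hJ, hyt⟩
    obtain ⟨hJ0, hJI⟩ := hJ.isYoungPath hT
    have := hI.eq_of_eqOn hJI (fun _ _ _ => rfl) ht.1 ht.2
    rw [h0, hJ0, sub_zero, sub_zero] at this
    rw [hyt, picardMap, this]
  · intro hyt
    have hz := hy.comp_coeff hσ hγ0 hγ1 ht
    have hcz : 0 ≤ L * (T ^ (1 - γ) + |c|) :=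
      mul_nonneg hσ.nonneg (add_nonneg (Real.rpow_nonneg hT _) (abs_nonneg _))
    have hK := (sewConst_pos (by linarith : 1 < γ + γ)).le
    refine ⟨_, hI.isYoungIntegral hγ0 hγ0 (by linarith) hcz hX hz hx ?_, ?_⟩
    · refine ((hI.blockHolder hγ0 hγ0 (by linarith) one_pos hcz hX (hz.blockHolder one_pos hcz)
        le_rfl hx).holderBound one_pos hγ0 ?_).continuousOn hγ0
      positivity
    · rw [h0, sub_zero]
      exact hyt

lemma picardMap_zero [CompleteSpace W] [ProperSpace V] {T κ L γ c X : ℝ}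
    {σ : ℝ × ℝ × V → W →L[ℝ] V} {x : ℝ → W} {y : ℝ → V} {a : V} (hT : 0 ≤ T)
    (hσ : IncrementBounds T κ L σ) (hγ : 1 / 2 < γ) (hγ1 : γ < 1) (hX : 0 ≤ X)
    (hx : HolderBound 0 T γ X x) (hy : HolderBound 0 T γ c y) : picardMap T σ a x y 0 = a := by
  rw [picardMap, (youngPrimitive_coeff hσ hγ hγ1 hX hx hy ⟨le_rfl, hT⟩).1, add_zero]

/-- **A priori estimate.** As `σ` grows at most linearly, some set of block `γ`-Hölder paths is
stable under `picardMap`. -/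
lemma exists_invariant [CompleteSpace W] [ProperSpace V] {T κ L γ X : ℝ}
    {σ : ℝ × ℝ × V → W →L[ℝ] V} {x : ℝ → W} (a : V) (hT : 0 ≤ T) (hσ : IncrementBounds T κ L σ)
    (hγ : 1 / 2 < γ) (hγ1 : γ < 1) (hX : 0 ≤ X) (hx : HolderBound 0 T γ X x) :
    ∃ ε c : ℝ, 0 < ε ∧ 0 ≤ c ∧ ∀ y : ℝ → V, y 0 = a → BlockHolder T ε γ c y →
      BlockHolder T ε γ c (picardMap T σ a x y) := by
  have hγ0 : 0 < γ := by linarith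
  have hγγ : 1 < γ + γ := by linarith
  have hK := (sewConst_pos hγγ).le
  have hL := hσ.nonneg
  set A := ‖σ (0, 0, a)‖ + L * T with hA
  have hA0 : 0 ≤ A := by positivity
  -- `X * (A + 2 * L)` is the part of the bound of `blockHolder_volterra` that does not shrink with
  -- the blocks; once `c` is chosen larger, small blocks absorb the rest
  set c := X * (A + 2 * L) + 1 with hc
  have hc0 : 0 ≤ c := by positivity
  obtain ⟨ε, hε, hε1, hsmall⟩ := exists_small_block (β := γ)
    (B := 3 * X * (2 + sewConst (γ + γ)) * (L * (1 + c))) hγ0 (by positivity)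
  refine ⟨ε, c, hε, hc0, fun y hy0 hy => ?_⟩
  have h0 : (0 : ℝ) ∈ Icc 0 T := ⟨le_rfl, hT⟩
  have hyH := hy.holderBound hε hγ0 hc0
  -- the path `u ↦ (u, y u)` is block Hölder
  have hq : ∀ (k : ℕ) (u v : ℝ), k * ε ≤ u → u ≤ v → v ≤ (k + 1) * ε → v ≤ T →
      ‖(v, y v) - (u, y u)‖ ≤ (1 + c) * 2 ^ k * (v - u) ^ γ := fun k u v h1 h2 h3 h4 => by
    have hr0 := sub_nonneg.2 h2
    have hr := Real.rpow_nonneg hr0 γ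
    have e1 : v - u ≤ (v - u) ^ γ := by
      simpa using Real.rpow_le_rpow_of_exponent_ge' hr0
        (sub_le_one_of_mem_block hε1 h1 h3) hγ0.le hγ1.le
    have e2 := hy k u v h1 h2 h3 h4
    have hone : (1 : ℝ) ≤ 2 ^ k := one_le_pow₀ one_le_two
    have e3 : (v - u) ^ γ ≤ 2 ^ k * (v - u) ^ γ := le_mul_of_one_le_left hr hone
    have e4 : 0 ≤ c * 2 ^ k * (v - u) ^ γ := by positivity
    simp only [Prod.mk_sub_mk, Prod.norm_def, Real.norm_of_nonneg hr0]
    refine max_le ?_ ?_ <;> linarith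
  have key := blockHolder_volterra (T := T) (z := fun t u => σ (t, u, y u))
    (I := fun t => youngPrimitive T (fun u => σ (t, u, y u)) x) (c := L * (1 + c)) (A := A)
    (A' := L) hγ0 hγ0 hγγ hγ0 le_rfl hε hε1 (by positivity) hX hA0 hL hx
    (fun t ht => (youngPrimitive_coeff hσ hγ hγ1 hX hx hyH ht).2)
    (fun t ht => (youngPrimitive_coeff hσ hγ hγ1 hX hx hyH ht).1)
    ?_ ?_ ?_ ?_
  · intro k s t h1 h2 h3 h4
    have := (key.mono_const (c' := c) (by linarith)) k s t h1 h2 h3 h4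
    simpa only [picardMap, add_sub_add_left_eq_sub] using this
  · intro t ht k u v h1 h2 h3 h4
    have hu : 0 ≤ u := (by positivity : (0 : ℝ) ≤ k * ε).trans h1
    have e := hσ.lip (t, v, y v) ⟨ht, ⟨hu.trans h2, h4⟩, mem_univ _⟩ (t, u, y u)
      ⟨ht, ⟨hu, h2.trans h4⟩, mem_univ _⟩
    have e' : ‖(t, v, y v) - (t, u, y u)‖ = ‖(v, y v) - (u, y u)‖ := by simp [Prod.norm_def]
    rw [e'] at e
    refine e.trans ((mul_le_mul_of_nonneg_left (hq k u v h1 h2 h3 h4) hL).trans (le_of_eq ?_))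
    ring
  · intro t ht
    have e := hσ.lip (t, 0, y 0) ⟨ht, h0, mem_univ _⟩ (0, 0, y 0) ⟨h0, h0, mem_univ _⟩
    have e' : ‖(t, (0 : ℝ), y 0) - (0, 0, y 0)‖ = t := by
      simp [Prod.norm_def, abs_of_nonneg ht.1, ht.1]
    rw [e', hy0] at e
    have e3 := norm_le_norm_add_norm_sub' (σ (t, 0, a)) (σ (0, 0, a))
    have e4 : L * t ≤ L * T := mul_le_mul_of_nonneg_left ht.2 hL
    simp only [hy0]
    linarith
  · intro s hs t ht hst hst1 k u v h1 h2 h3 h4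
    have hu : 0 ≤ u := (by positivity : (0 : ℝ) ≤ k * ε).trans h1
    have hts0 := sub_nonneg.2 hst
    have e := hσ.lip_sub s hs t ht (v, y v) ⟨⟨hu.trans h2, h4⟩, mem_univ _⟩ (u, y u)
      ⟨⟨hu, h2.trans h4⟩, mem_univ _⟩
    rw [abs_of_nonneg hts0] at e
    have e1 : t - s ≤ (t - s) ^ γ := by
      simpa using Real.rpow_le_rpow_of_exponent_ge' hts0 hst1 hγ0.le hγ1.le
    calc _ ≤ L * (t - s) * ‖(v, y v) - (u, y u)‖ := e
      _ ≤ L * (t - s) ^ γ * ((1 + c) * 2 ^ k * (v - u) ^ γ) := by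
          gcongr
          exact hq k u v h1 h2 h3 h4
      _ = _ := by ring
  · intro s hs t ht hst hst1
    have hts0 := sub_nonneg.2 hst
    have e := hσ.lip (t, 0, y 0) ⟨ht, h0, mem_univ _⟩ (s, 0, y 0) ⟨hs, h0, mem_univ _⟩
    have e' : ‖(t, (0 : ℝ), y 0) - (s, 0, y 0)‖ = t - s := by
      simp [Prod.norm_def, abs_of_nonneg hts0, hst]
    rw [e'] at e
    refine e.trans (mul_le_mul_of_nonneg_left ?_ hL)
    simpa using Real.rpow_le_rpow_of_exponent_ge' hts0 hst1 hγ0.le hγ1.le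

/-- **Contraction.** On `γ`-Hölder paths with a common bound, `picardMap` halves the block
`β`-Hölder constant of differences, for `β ≤ min κ γ` with `β + γ > 1` and small blocks. The bound
`β ≤ κ` is what allows the increment of `σ` in its first variable to be of order
`|t - s|^κ` only. -/
lemma exists_contraction [CompleteSpace W] [ProperSpace V] {T κ L γ β X M : ℝ}
    {σ : ℝ × ℝ × V → W →L[ℝ] V} {x : ℝ → W} (a : V) (hσ : IncrementBounds T κ L σ)
    (hγ : 1 / 2 < γ) (hγ1 : γ < 1) (hX : 0 ≤ X) (hx : HolderBound 0 T γ X x) (hβ : 0 < β)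
    (hβγ : β ≤ γ) (hβκ : β ≤ κ) (hβγ1 : 1 < β + γ) (hM : 0 ≤ M) :
    ∃ ε : ℝ, 0 < ε ∧ ε ≤ 1 ∧ ∀ (y y' : ℝ → V) (c : ℝ), 0 ≤ c → y 0 = a → y' 0 = a →
      HolderBound 0 T γ M y → HolderBound 0 T γ M y' →
      BlockHolder T ε β c (fun t => y t - y' t) →
      BlockHolder T ε β (c / 2) (fun t => picardMap T σ a x y t - picardMap T σ a x y' t) := by
  have hγ0 : 0 < γ := by linarith
  have hK := (sewConst_pos hβγ1).le
  have hL := hσ.nonneg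
  obtain ⟨ε, hε, hε1, hsmall⟩ := exists_small_block (β := β)
    (B := 3 * X * (2 + sewConst (β + γ)) * (L * (1 + 2 * (1 + M)))) hβ (by positivity)
  refine ⟨ε, hε, hε1, fun y y' c hc hy0 hy0' hy hy' hw => ?_⟩
  -- increments of the two arguments `(u, y u)` and `(u, y' u)`, and of their difference
  have hq : ∀ y : ℝ → V, HolderBound 0 T γ M y → ∀ u v, 0 ≤ u → u ≤ v → v ≤ T → v - u ≤ 1 →
      ‖(v, y v) - (u, y u)‖ ≤ (1 + M) * (v - u) ^ β := fun y hy u v h1 h2 h3 h4 => by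
    have hr0 := sub_nonneg.2 h2
    have hr := Real.rpow_nonneg hr0 β
    have e1 : v - u ≤ (v - u) ^ β := by
      simpa using Real.rpow_le_rpow_of_exponent_ge' hr0 h4 hβ.le (hβγ.trans hγ1.le)
    have e2 : ‖y v - y u‖ ≤ M * (v - u) ^ β := (hy u v h1 h2 h3).trans
      (mul_le_mul_of_nonneg_left (Real.rpow_le_rpow_of_exponent_ge' hr0 h4 hβ.le hβγ) hM)
    have e3 := mul_nonneg hM hr
    simp only [Prod.mk_sub_mk, Prod.norm_def, Real.norm_of_nonneg hr0]
    refine max_le ?_ ?_ <;> linarith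
  have hdiff : ∀ u v : ℝ, ‖(v, y v) - (v, y' v) - ((u, y u) - (u, y' u))‖
      = ‖(y v - y' v) - (y u - y' u)‖ := fun u v => by simp [Prod.norm_def]
  have hdiff' : ∀ u : ℝ, ‖(u, y u) - (u, y' u)‖ = ‖y u - y' u‖ := fun u => by simp [Prod.norm_def]
  have hprod : ∀ (k : ℕ) (u v : ℝ), k * ε ≤ u → u ≤ v → v ≤ (k + 1) * ε → v ≤ T →
      max ‖(v, y v) - (u, y u)‖ ‖(v, y' v) - (u, y' u)‖ * ‖(u, y u) - (u, y' u)‖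
        ≤ 2 * (1 + M) * c * 2 ^ k * (v - u) ^ β := fun k u v h1 h2 h3 h4 => by
    have hu : 0 ≤ u := (by positivity : (0 : ℝ) ≤ k * ε).trans h1
    have h5 := sub_le_one_of_mem_block hε1 h1 h3
    have e1 : ‖(u, y u) - (u, y' u)‖ ≤ 2 * c * 2 ^ k * 1 := by
      have := hw.norm_sub_zero_le hε hβ hc h1 (h2.trans h3) (h2.trans h4)
      rw [hy0, hy0', sub_self, sub_zero] at this
      rw [hdiff']
      refine this.trans (mul_le_mul_of_nonneg_left ?_ (by positivity))
      exact Real.rpow_le_one hε.le hε1 hβ.le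
    have e2 := max_le (hq y hy u v hu h2 h4 h5) (hq y' hy' u v hu h2 h4 h5)
    refine (mul_le_mul e2 e1 (norm_nonneg _) ((norm_nonneg _).trans
      ((le_max_left _ _).trans e2))).trans (le_of_eq ?_)
    ring
  have hspec := fun t ht => youngPrimitive_coeff (t := t) hσ hγ hγ1 hX hx hy ht
  have hspec' := fun t ht => youngPrimitive_coeff (t := t) hσ hγ hγ1 hX hx hy' ht
  have key := blockHolder_volterra (T := T) (z := fun t u => σ (t, u, y u) - σ (t, u, y' u))
    (I := fun t u => youngPrimitive T (fun u => σ (t, u, y u)) x u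
      - youngPrimitive T (fun u => σ (t, u, y' u)) x u) (c := L * (1 + 2 * (1 + M)) * c) (A := 0)
    (A' := 0) hβ hγ0 hβγ1 hβ hβγ hε hε1 (by positivity) hX le_rfl le_rfl hx
    (fun t ht => (hspec t ht).2.sub (hspec' t ht).2)
    (fun t ht => by rw [(hspec t ht).1, (hspec' t ht).1, sub_self])
    ?_ ?_ ?_ ?_
  · intro k s t h1 h2 h3 h4
    have := (key.mono_const (c' := c / 2) (by nlinarith)) k s t h1 h2 h3 h4
    simpa only [picardMap, add_sub_add_left_eq_sub] using this
  · intro t ht k u v h1 h2 h3 h4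
    have hu : u ∈ Icc 0 T := ⟨(by positivity : (0 : ℝ) ≤ k * ε).trans h1, h2.trans h4⟩
    have hv : v ∈ Icc 0 T := ⟨hu.1.trans h2, h4⟩
    have e := hσ.four t ht (v, y v) ⟨hv, mem_univ _⟩ (v, y' v) ⟨hv, mem_univ _⟩
      (u, y u) ⟨hu, mem_univ _⟩ (u, y' u) ⟨hu, mem_univ _⟩
    rw [hdiff] at e
    have e1 := hw k u v h1 h2 h3 h4
    have e2 := hprod k u v h1 h2 h3 h4
    refine e.trans ((add_le_add (mul_le_mul_of_nonneg_left e1 hL)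
      (mul_le_mul_of_nonneg_left e2 hL)).trans (le_of_eq ?_))
    ring
  · intro t ht
    simp [hy0, hy0']
  · intro s hs t ht hst hst1 k u v h1 h2 h3 h4
    have hu : u ∈ Icc 0 T := ⟨(by positivity : (0 : ℝ) ≤ k * ε).trans h1, h2.trans h4⟩
    have hv : v ∈ Icc 0 T := ⟨hu.1.trans h2, h4⟩
    have hts0 := sub_nonneg.2 hst
    have e := hσ.eight s hs t ht (v, y v) ⟨hv, mem_univ _⟩ (v, y' v) ⟨hv, mem_univ _⟩
      (u, y u) ⟨hu, mem_univ _⟩ (u, y' u) ⟨hu, mem_univ _⟩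
    rw [hdiff, abs_of_nonneg hts0] at e
    have e1 := hw k u v h1 h2 h3 h4
    have e2 := hprod k u v h1 h2 h3 h4
    have e3 : t - s ≤ (t - s) ^ β := by
      simpa using Real.rpow_le_rpow_of_exponent_ge' hts0 hst1 hβ.le (hβγ.trans hγ1.le)
    have e4 : (t - s) ^ κ ≤ (t - s) ^ β :=
      Real.rpow_le_rpow_of_exponent_ge' hts0 hst1 hβ.le hβκ
    have hr := Real.rpow_nonneg hts0 β
    have e5 : L * (t - s) * ‖(y v - y' v) - (y u - y' u)‖
        ≤ L * (t - s) ^ β * (c * 2 ^ k * (v - u) ^ β) := by gcongr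
    have e6 : L * (t - s) ^ κ * (max ‖(v, y v) - (u, y u)‖ ‖(v, y' v) - (u, y' u)‖
        * ‖(u, y u) - (u, y' u)‖)
        ≤ L * (t - s) ^ β * (2 * (1 + M) * c * 2 ^ k * (v - u) ^ β) := by gcongr
    have e7 : σ (t, v, y v) - σ (t, v, y' v) - (σ (s, v, y v) - σ (s, v, y' v))
        - (σ (t, u, y u) - σ (t, u, y' u) - (σ (s, u, y u) - σ (s, u, y' u)))
        = σ (t, v, y v) - σ (s, v, y v) - (σ (t, v, y' v) - σ (s, v, y' v))
        - (σ (t, u, y u) - σ (s, u, y u) - (σ (t, u, y' u) - σ (s, u, y' u))) := by abel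
    simp only [e7]
    refine e.trans ((add_le_add e5 e6).trans (le_of_eq ?_))
    ring
  · intro s _ t _ _ _
    simp [hy0, hy0']

/-- **Uniqueness.** The difference of two fixed points has block Hölder constants `c / 2^m`. -/
lemma eqOn_of_isSolution [CompleteSpace W] [ProperSpace V] {T κ L γ X M : ℝ}
    {σ : ℝ × ℝ × V → W →L[ℝ] V} {x : ℝ → W} {a : V} (hT : 0 ≤ T) (hσ : IncrementBounds T κ L σ)
    (hγ : 1 / 2 < γ) (hγ1 : γ < 1) (hκ : 0 < κ) (hκγ : 1 < κ + γ) (hX : 0 ≤ X)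
    (hx : HolderBound 0 T γ X x) (hM : 0 ≤ M) {y y' : ℝ → V} (hy : HolderBound 0 T γ M y)
    (hy' : HolderBound 0 T γ M y') (hs : IsSolution T σ a x y) (hs' : IsSolution T σ a x y') :
    EqOn y' y (Icc 0 T) := by
  have hγ0 : 0 < γ := by linarith
  have hβ : 0 < min κ γ := lt_min hκ hγ0
  obtain ⟨ε, hε, hε1, hcontr⟩ := exists_contraction (β := min κ γ) a hσ hγ hγ1 hX hx hβ
    (min_le_right _ _) (min_le_left _ _) (by rcases min_choice κ γ with h | h <;> rw [h] <;>
      linarith) hM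
  have hfix := (isSolution_iff hσ hγ hγ1 hX hx hy).1 hs
  have hfix' := (isSolution_iff hσ hγ hγ1 hX hx hy').1 hs'
  have h0 : (0 : ℝ) ∈ Icc 0 T := ⟨le_rfl, hT⟩
  have hy0 : y 0 = a := by rw [hfix 0 h0, picardMap_zero hT hσ hγ hγ1 hX hx hy]
  have hy0' : y' 0 = a := by rw [hfix' 0 h0, picardMap_zero hT hσ hγ hγ1 hX hx hy']
  have hw : ∀ m : ℕ, BlockHolder T ε (min κ γ) ((M + M) * (1 / 2) ^ m) fun t => y t - y' t := by
    intro m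
    induction m with
    | zero =>
      rw [pow_zero, mul_one]
      exact ((hy.sub hy').blockHolder hε (by positivity)).mono_exponent hε1 (by positivity) hβ
        (min_le_right _ _)
    | succ m ih =>
      intro k s t h1 h2 h3 h4
      have hs : s ∈ Icc 0 T := ⟨(by positivity : (0 : ℝ) ≤ k * ε).trans h1, h2.trans h4⟩
      have := hcontr y y' _ (by positivity) hy0 hy0' hy hy' ih k s t h1 h2 h3 h4
      beta_reduce at this
      rw [← hfix s hs, ← hfix' s hs, ← hfix t ⟨hs.1.trans h2, h4⟩,
        ← hfix' t ⟨hs.1.trans h2, h4⟩] at this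
      exact this.trans (le_of_eq (by ring))
  intro t ht
  have hlim : Tendsto (fun m : ℕ => (M + M) * (1 / 2 : ℝ) ^ m
      * (2 * 2 ^ ⌊T / ε⌋₊ * ε ^ min κ γ)) atTop
      (𝓝 ((M + M) * 0 * (2 * 2 ^ ⌊T / ε⌋₊ * ε ^ min κ γ))) :=
    ((tendsto_pow_atTop_nhds_zero_of_lt_one (by norm_num) (by norm_num)).const_mul _).mul_const _
  rw [mul_zero, zero_mul] at hlim
  have hle : ‖y t - y' t‖ ≤ 0 := ge_of_tendsto' hlim fun m => by
    simpa [hy0, hy0'] using (hw m).norm_sub_zero_le_total hε hβ (by positivity) ht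
  exact (sub_eq_zero.1 (norm_le_zero_iff.1 hle)).symm

/-- **Existence.** The Picard iterates are bounded in `C^γ` and converge geometrically in the block
Hölder seminorm of exponent `min κ γ`. -/
lemma exists_isSolution [CompleteSpace W] [ProperSpace V] {T κ L γ X : ℝ}
    {σ : ℝ × ℝ × V → W →L[ℝ] V} {x : ℝ → W} (a : V) (hT : 0 ≤ T) (hσ : IncrementBounds T κ L σ)
    (hγ : 1 / 2 < γ) (hγ1 : γ < 1) (hκ : 0 < κ) (hκγ : 1 < κ + γ) (hX : 0 ≤ X)
    (hx : HolderBound 0 T γ X x) :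
    ∃ (y : ℝ → V) (M : ℝ), HolderBound 0 T γ M y ∧ IsSolution T σ a x y := by
  have hγ0 : 0 < γ := by linarith
  have hβ : 0 < min κ γ := lt_min hκ hγ0
  obtain ⟨δ, c, hδ, hc, hinv⟩ := exists_invariant a hT hσ hγ hγ1 hX hx
  set M := (⌊T / δ⌋₊ + 1) * (c * 2 ^ ⌊T / δ⌋₊) with hM_def
  have hM : 0 ≤ M := by positivity
  set Y : ℕ → ℝ → V := fun m => (picardMap T σ a x)^[m] fun _ => a with hY
  have hsucc : ∀ m, Y (m + 1) = picardMap T σ a x (Y m) := fun m =>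
    Function.iterate_succ_apply' _ _ _
  have hYB : ∀ m, Y m 0 = a ∧ BlockHolder T δ γ c (Y m) := by
    intro m
    induction m with
    | zero =>
      refine ⟨rfl, fun k s t _ h2 _ _ => ?_⟩
      have := Real.rpow_nonneg (sub_nonneg.2 h2) γ
      simp only [hY, Function.iterate_zero, id_eq, sub_self, norm_zero]
      positivity
    | succ m ih =>
      rw [hsucc]
      exact ⟨picardMap_zero hT hσ hγ hγ1 hX hx (ih.2.holderBound hδ hγ0 hc), hinv _ ih.1 ih.2⟩
  have hYM : ∀ m, HolderBound 0 T γ M (Y m) := fun m => (hYB m).2.holderBound hδ hγ0 hc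
  obtain ⟨ε, hε, hε1, hcontr⟩ := exists_contraction (β := min κ γ) a hσ hγ hγ1 hX hx hβ
    (min_le_right _ _) (min_le_left _ _) (by rcases min_choice κ γ with h | h <;> rw [h] <;>
      linarith) hM
  have hw : ∀ m : ℕ, BlockHolder T ε (min κ γ) ((M + M) * (1 / 2) ^ m)
      fun t => Y m t - Y (m + 1) t := by
    intro m
    induction m with
    | zero =>
      rw [pow_zero, mul_one]
      exact (((hYM 0).sub (hYM 1)).blockHolder hε (by positivity)).mono_exponent hε1
        (by positivity) hβ (min_le_right _ _)
    | succ m ih =>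
      have := hcontr (Y m) (Y (m + 1)) _ (by positivity) (hYB m).1 (hYB (m + 1)).1 (hYM m)
        (hYM (m + 1)) ih
      rw [← hsucc, ← hsucc] at this
      exact this.mono_const (le_of_eq (by ring))
  set D := 2 * 2 ^ ⌊T / ε⌋₊ * ε ^ min κ γ with hD
  have hconv : ∀ t ∈ Icc 0 T, ∃ l, Tendsto (fun m => Y m t) atTop (𝓝 l) := by
    intro t ht
    refine cauchySeq_tendsto_of_complete (cauchySeq_of_le_geometric (1 / 2) ((M + M) * D)
      (by norm_num) fun m => ?_)
    have := (hw m).norm_sub_zero_le_total hε hβ (by positivity) ht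
    rw [(hYB m).1, (hYB (m + 1)).1, sub_self, sub_zero] at this
    rw [dist_eq_norm]
    exact this.trans (le_of_eq (by ring))
  choose! y hy using hconv
  have hyM : HolderBound 0 T γ M y := fun s t h1 h2 h3 =>
    le_of_tendsto' ((hy t ⟨h1.trans h2, h3⟩).sub (hy s ⟨h1, h2.trans h3⟩)).norm
      fun m => hYM m s t h1 h2 h3
  have hy0 : y 0 = a := tendsto_nhds_unique (hy 0 ⟨le_rfl, hT⟩)
    (tendsto_const_nhds.congr fun m => (hYB m).1.symm)
  refine ⟨y, M, hyM, (isSolution_iff hσ hγ hγ1 hX hx hyM).2 fun t ht => ?_⟩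
  -- the distance of the iterates to their limit, summing the geometric series of increments
  have hdist : ∀ m : ℕ, BlockHolder T ε (min κ γ) (2 * (M + M) * (1 / 2) ^ m)
      fun t => Y m t - y t := by
    intro m k s t h1 h2 h3 h4
    have hs : s ∈ Icc 0 T := ⟨(by positivity : (0 : ℝ) ≤ k * ε).trans h1, h2.trans h4⟩
    have h5 := dist_le_of_le_geometric_of_tendsto (1 / 2)
      ((M + M) * 2 ^ k * (t - s) ^ min κ γ) (f := fun m => Y m t - Y m s) (a := y t - y s)
      (by norm_num) (fun m => ?_) ((hy t ⟨hs.1.trans h2, h4⟩).sub (hy s hs)) m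
    · rw [dist_eq_norm, sub_sub_sub_comm] at h5
      exact h5.trans (le_of_eq (by ring))
    · rw [dist_eq_norm, sub_sub_sub_comm]
      exact (hw m k s t h1 h2 h3 h4).trans (le_of_eq (by ring))
  have hlim : Tendsto (fun m => Y (m + 1) t) atTop (𝓝 (picardMap T σ a x y t)) := by
    rw [tendsto_iff_norm_sub_tendsto_zero]
    have h0 : Tendsto (fun m : ℕ => 2 * (M + M) * (1 / 2 : ℝ) ^ m / 2 * D) atTop
        (𝓝 (2 * (M + M) * 0 / 2 * D)) :=
      (((tendsto_pow_atTop_nhds_zero_of_lt_one (by norm_num) (by norm_num)).const_mul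
        _).div_const _).mul_const _
    rw [mul_zero, zero_div, zero_mul] at h0
    refine squeeze_zero (fun _ => norm_nonneg _) (fun m => ?_) h0
    have := (hcontr (Y m) y _ (by positivity) (hYB m).1 hy0 (hYM m) hyM
      (hdist m)).norm_sub_zero_le_total hε hβ (by positivity) ht
    rw [picardMap_zero hT hσ hγ hγ1 hX hx (hYM m), picardMap_zero hT hσ hγ hγ1 hX hx hyM,
      sub_self, sub_zero, ← hsucc] at this
    exact this
  exact tendsto_nhds_unique ((hy t ht).comp (tendsto_add_atTop_nat 1)) hlim

/-- Existence and uniqueness for the Volterra equation driven by a `γ`-Hölder path. -/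
lemma exists_unique_isSolution [CompleteSpace W] [ProperSpace V] {T γ κ X : ℝ}
    (hT : 0 < T) (hγ : 1 / 2 < γ) (hγ1 : γ < 1) (hκ : 0 < κ) (hκγ : 1 < κ + γ) {x : ℝ → W}
    (hX : 0 ≤ X) (hx : HolderBound 0 T γ X x) (a : V) {σ : ℝ × ℝ × V → W →L[ℝ] V}
    (hσ : MemCkbHolder 2 κ (Icc 0 T ×ˢ Icc 0 T ×ˢ univ) σ) :
    ∃ y : ℝ → V, (MemC₁ T γ y ∧ IsSolution T σ a x y) ∧
      ∀ y' : ℝ → V, MemC₁ T γ y' → IsSolution T σ a x y' → EqOn y' y (Icc 0 T) := by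
  have hγ0 : 0 < γ := by linarith
  obtain ⟨L, hL⟩ := hσ.exists_incrementBounds hT
  obtain ⟨y, M, hy, hsol⟩ := exists_isSolution a hT.le hL hγ hγ1 hκ hκγ hX hx
  refine ⟨y, ⟨hy.memC₁ hγ0, hsol⟩, fun y' hy' hsol' => ?_⟩
  obtain ⟨M', hM', hyM'⟩ := hy'.exists_holderBound
  have hmono : ∀ {f : ℝ → V} {c : ℝ}, HolderBound 0 T γ c f → c ≤ max |M| M' →
      HolderBound 0 T γ (max |M| M') f := fun hf hc s t h1 h2 h3 =>
    (hf s t h1 h2 h3).trans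
      (mul_le_mul_of_nonneg_right hc (Real.rpow_nonneg (sub_nonneg.2 h2) _))
  exact eqOn_of_isSolution hT.le hL hγ hγ1 hκ hκγ hX hx (le_max_of_le_right hM')
    (hmono hy ((le_abs_self M).trans (le_max_left _ _))) (hmono hyM' (le_max_right _ _)) hsol hsol'

end Volterra

/-! ### Hölder continuity of the paths of fractional Brownian motion -/

section FractionalBrownianPaths

/-- The dyadic approximations of `t` from below at levels `n` and `n + 1` are equal or neighbours on
the finer grid, and the interval between neighbours lies in `[0, 1]`. -/
lemma dyadic_floor_step {t : ℝ} (ht0 : 0 ≤ t) (ht1 : t ≤ 1) (n : ℕ) :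
    ⌊2 ^ (n + 1) * t⌋₊ = 2 * ⌊2 ^ n * t⌋₊ ∨
      ⌊2 ^ (n + 1) * t⌋₊ = 2 * ⌊2 ^ n * t⌋₊ + 1 ∧ 2 * ⌊2 ^ n * t⌋₊ < 2 ^ (n + 1) := by
  have h1 : (⌊2 ^ n * t⌋₊ : ℝ) ≤ 2 ^ n * t := Nat.floor_le (by positivity)
  have h2 : 2 ^ n * t < ⌊2 ^ n * t⌋₊ + 1 := Nat.lt_floor_add_one _
  have h3 : 2 * ⌊2 ^ n * t⌋₊ ≤ ⌊2 ^ (n + 1) * t⌋₊ := Nat.le_floor (by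
    push_cast; rw [pow_succ]; linarith)
  have h4 : ⌊2 ^ (n + 1) * t⌋₊ < 2 * ⌊2 ^ n * t⌋₊ + 2 := (Nat.floor_lt (by positivity)).2 (by
    push_cast; rw [pow_succ]; linarith)
  have h5 : ⌊2 ^ (n + 1) * t⌋₊ ≤ 2 ^ (n + 1) := Nat.floor_le_of_le (by
    push_cast
    exact mul_le_of_le_one_right (by positivity) ht1)
  omega

/-- **Chaining.** A continuous function on `[0, 1]` is `γ`-Hölder if its increments between
neighbours of the `n`-th dyadic grid are `O(2^{-γn})`. -/
lemma exists_holderBound_of_dyadic {f : ℝ → ℝ} {γ C : ℝ} (hγ : 0 < γ) (hC : 0 ≤ C)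
    (hf : Continuous f)
    (h : ∀ n i : ℕ, i < 2 ^ n →
      |f ((i + 1) / 2 ^ n) - f (i / 2 ^ n)| ≤ C * ((1 / 2 : ℝ) ^ γ) ^ n) :
    ∃ C', HolderBound 0 1 γ C' f := by
  set r : ℝ := (1 / 2 : ℝ) ^ γ with hr
  have hr0 : 0 < r := by positivity
  have hr1 : r < 1 := Real.rpow_lt_one (by norm_num) (by norm_num) hγ
  have hpow : ∀ n : ℕ, (0 : ℝ) < 2 ^ n := fun n => by positivity
  -- distance to the dyadic approximation from below
  have happrox : ∀ t ∈ Icc (0 : ℝ) 1, ∀ m : ℕ,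
      |f (⌊2 ^ m * t⌋₊ / 2 ^ m) - f t| ≤ C * r * r ^ m / (1 - r) := by
    intro t ht m
    have hlim : Tendsto (fun n : ℕ => (⌊2 ^ n * t⌋₊ : ℝ) / 2 ^ n) atTop (𝓝 t) := by
      have h1 := (tendsto_nat_floor_mul_div_atTop (R := ℝ) ht.1).comp
        (tendsto_pow_atTop_atTop_of_one_lt (one_lt_two (α := ℝ)))
      exact h1.congr fun n => by simp [mul_comm]
    refine dist_le_of_le_geometric_of_tendsto r (C * r)
      (f := fun n : ℕ => f ((⌊2 ^ n * t⌋₊ : ℝ) / 2 ^ n)) hr1 (fun n => ?_)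
      ((hf.tendsto t).comp hlim) m
    have e : (⌊2 ^ n * t⌋₊ : ℝ) / 2 ^ n = (2 * ⌊2 ^ n * t⌋₊ : ℕ) / 2 ^ (n + 1) := by
      push_cast
      rw [pow_succ]
      field_simp
    rw [dist_comm, Real.dist_eq, e]
    rcases dyadic_floor_step ht.1 ht.2 n with h' | ⟨h', h''⟩
    · rw [h', sub_self, abs_zero]
      positivity
    · rw [h']
      have := h (n + 1) _ h''
      rw [pow_succ r] at this
      push_cast at this ⊢
      exact this.trans (le_of_eq (by ring))
  refine ⟨(C + 2 * (C * r / (1 - r))) * 2 ^ γ, fun s t hs hst ht => ?_⟩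
  rcases hst.eq_or_lt with rfl | hlt
  · simp [Real.zero_rpow hγ.ne']
  obtain ⟨m, hm1, hm2⟩ := exists_nat_pow_near_of_lt_one (x := t - s) (y := 1 / 2)
    (sub_pos.2 hlt) (by linarith) (by norm_num) (by norm_num)
  have hs' := happrox s ⟨hs, hst.trans ht⟩ m
  have ht' := happrox t ⟨hs.trans hst, ht⟩ m
  -- at the scale of `t - s`, the two approximations are equal or neighbours
  have hst' : |f (⌊2 ^ m * t⌋₊ / 2 ^ m) - f (⌊2 ^ m * s⌋₊ / 2 ^ m)| ≤ C * r ^ m := by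
    have h1 : ⌊2 ^ m * s⌋₊ ≤ ⌊2 ^ m * t⌋₊ :=
      Nat.floor_le_floor (mul_le_mul_of_nonneg_left hst (hpow m).le)
    have h2 : ⌊2 ^ m * t⌋₊ ≤ ⌊2 ^ m * s⌋₊ + 1 := by
      rw [← Nat.floor_add_one (mul_nonneg (hpow m).le hs)]
      refine Nat.floor_le_floor ?_
      have : 2 ^ m * (t - s) ≤ 2 ^ m * (1 / 2) ^ m := mul_le_mul_of_nonneg_left hm2 (hpow m).le
      rw [← mul_pow] at this
      norm_num at this
      linarith
    have h3 : ⌊2 ^ m * t⌋₊ ≤ 2 ^ m := Nat.floor_le_of_le (by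
      push_cast
      exact mul_le_of_le_one_right (by positivity) ht)
    rcases (by omega : ⌊2 ^ m * t⌋₊ = ⌊2 ^ m * s⌋₊ ∨ ⌊2 ^ m * t⌋₊ = ⌊2 ^ m * s⌋₊ + 1) with h' | h'
    · rw [h', sub_self, abs_zero]
      positivity
    · rw [h']
      push_cast
      exact h m _ (by omega)
  have hrm : r ^ m ≤ 2 ^ γ * (t - s) ^ γ := by
    rw [hr, ← Real.rpow_mul_natCast (by norm_num), mul_comm γ, Real.rpow_natCast_mul (by norm_num),
      ← Real.mul_rpow (by norm_num) (by linarith)]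
    refine Real.rpow_le_rpow (by positivity) ?_ hγ.le
    rw [pow_succ] at hm1
    linarith
  have hsum : |f t - f s| ≤ (C + 2 * (C * r / (1 - r))) * r ^ m := by
    have e : f t - f s = (f (⌊2 ^ m * t⌋₊ / 2 ^ m) - f (⌊2 ^ m * s⌋₊ / 2 ^ m))
        - (f (⌊2 ^ m * t⌋₊ / 2 ^ m) - f t) + (f (⌊2 ^ m * s⌋₊ / 2 ^ m) - f s) := by ring
    rw [e]
    calc _ ≤ C * r ^ m + C * r * r ^ m / (1 - r) + C * r * r ^ m / (1 - r) :=
          (abs_add_le _ _).trans (add_le_add ((abs_sub _ _).trans (add_le_add hst' ht')) hs')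
      _ = _ := by ring
  have h1r : 0 < 1 - r := by linarith
  rw [Real.norm_eq_abs, mul_assoc]
  exact hsum.trans (mul_le_mul_of_nonneg_left hrm (by positivity))

variable {Ω : Type*} [MeasurableSpace Ω] {P : Measure Ω} {H : ℝ} {X : ℝ≥0 → Ω → ℝ}

lemma IsFractionalBrownianReal.variance_sub (hX : IsFractionalBrownianReal H X P) (hH : 0 < H)
    (s t : ℝ≥0) : Var[X t - X s; P] = |(t : ℝ) - s| ^ (2 * H) := by
  have := hX.isGaussianProcess.isProbabilityMeasure
  have hs := (hX.isGaussianProcess.hasGaussianLaw_eval s)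
  have ht := (hX.isGaussianProcess.hasGaussianLaw_eval t)
  rw [ProbabilityTheory.variance_sub ht.memLp_two hs.memLp_two, ← covariance_self ht.aemeasurable,
    ← covariance_self hs.aemeasurable, hX.covariance, hX.covariance, hX.covariance, sub_self,
    sub_self, abs_zero, Real.zero_rpow (by positivity), abs_sub_comm]
  ring

/-- Moments of the increments, from the scaling of centered Gaussian laws. -/
lemma IsFractionalBrownianReal.lintegral_enorm_sub_pow (hX : IsFractionalBrownianReal H X P)
    (hH : 0 < H) (p : ℕ) (s t : ℝ≥0) :
    ∫⁻ ω, ‖X t ω - X s ω‖ₑ ^ p ∂P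
      = ENNReal.ofReal ((|(t : ℝ) - s| ^ H) ^ p) * ∫⁻ u, ‖u‖ₑ ^ p ∂gaussianReal 0 1 := by
  have := hX.isGaussianProcess.isProbabilityMeasure
  have hs := (hX.isGaussianProcess.hasGaussianLaw_eval s)
  have ht := (hX.isGaussianProcess.hasGaussianLaw_eval t)
  have hlaw := hX.isGaussianProcess.hasGaussianLaw_sub (s := t) (t := s)
  have hmean : ∫ ω, (X t - X s) ω ∂P = 0 := by
    simp only [Pi.sub_apply]
    rw [integral_sub ht.integrable hs.integrable, hX.centered, hX.centered, sub_self]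
  have hmap := hlaw.map_eq_gaussianReal
  rw [hmean, hX.variance_sub hH] at hmap
  have hscale : gaussianReal 0 (|(t : ℝ) - s| ^ (2 * H)).toNNReal
      = (gaussianReal 0 1).map (|(t : ℝ) - s| ^ H * ·) := by
    rw [gaussianReal_map_const_mul, mul_zero, mul_one]
    congr 1
    ext
    rw [Real.coe_toNNReal _ (by positivity), NNReal.coe_mk, ← Real.rpow_mul_natCast (abs_nonneg _)]
    congr 1
    push_cast; ring
  have hmeas : Measurable fun u : ℝ => ‖u‖ₑ ^ p := by fun_prop
  calc ∫⁻ ω, ‖X t ω - X s ω‖ₑ ^ p ∂P = ∫⁻ u, ‖u‖ₑ ^ p ∂(P.map (X t - X s)) := by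
        rw [lintegral_map' hmeas.aemeasurable hlaw.aemeasurable]; rfl
    _ = ∫⁻ u, ENNReal.ofReal ((|(t : ℝ) - s| ^ H) ^ p) * ‖u‖ₑ ^ p ∂gaussianReal 0 1 := by
        rw [hmap, hscale, lintegral_map hmeas (by fun_prop)]
        refine lintegral_congr fun u => ?_
        rw [enorm_mul, mul_pow, ENNReal.ofReal_pow (by positivity),
          Real.enorm_of_nonneg (by positivity)]
    _ = _ := lintegral_const_mul _ hmeas

lemma lintegral_enorm_pow_gaussianReal_lt_top (p : ℕ) :
    ∫⁻ u, ‖u‖ₑ ^ p ∂gaussianReal 0 1 < ⊤ := by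
  rcases Nat.eq_zero_or_pos p with rfl | hp
  · simp
  have h := (memLp_id_gaussianReal (μ := 0) (v := 1) (p : ℝ≥0)).eLpNorm_lt_top
  rw [eLpNorm_lt_top_iff_lintegral_rpow_enorm_lt_top (by simpa using hp.ne') (by simp)] at h
  simpa using h

/-- **Kolmogorov's criterion** for the paths on `[0, T]`: with `p (H - γ) > 1`, the dyadic
increments at level `n`, rescaled by `2^{γn}`, have summable `p`-th moments. -/
lemma IsFractionalBrownianReal.ae_exists_holderBound (hX : IsFractionalBrownianReal H X P)
    (hH : 0 < H) {γ T : ℝ} (hγ : 0 < γ) (hγH : γ < H) (hT : 0 < T) :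
    ∀ᵐ ω ∂P, ∃ C, HolderBound 0 T γ C (samplePath X ω) := by
  obtain ⟨p, hp⟩ := exists_nat_gt (1 / (H - γ))
  have hHγ : 0 < H - γ := sub_pos.2 hγH
  have hp1 : 1 < p * (H - γ) := (div_lt_iff₀ hHγ).1 hp
  have hp0 : p ≠ 0 := by rintro rfl; norm_num at hp1
  set r : ℝ := (1 / 2 : ℝ) ^ γ with hr
  have hr0 : 0 < r := by positivity
  set τ : ℕ → ℕ → ℝ≥0 := fun n i => (T * (i / 2 ^ n)).toNNReal with hτ
  have hτ' : ∀ n i : ℕ, (τ n i : ℝ) = T * (i / 2 ^ n) := fun n i =>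
    Real.coe_toNNReal _ (by positivity)
  set Z : ℕ → ℕ → Ω → ENNReal := fun n i ω =>
    ENNReal.ofReal ((r⁻¹ ^ n) ^ p) * ‖X (τ n (i + 1)) ω - X (τ n i) ω‖ₑ ^ p with hZ
  have hmeas : ∀ n i, AEMeasurable (Z n i) P := fun n i => by
    have h1 := (hX.isGaussianProcess.aemeasurable (τ n (i + 1)))
    have h2 := (hX.isGaussianProcess.aemeasurable (τ n i))
    exact ((h1.sub h2).enorm.pow_const p).const_mul _
  set c := ∫⁻ u, ‖u‖ₑ ^ p ∂gaussianReal 0 1 with hc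
  set q : ℝ := 2 * (r⁻¹ * (1 / 2 : ℝ) ^ H) ^ p with hq
  have hq0 : 0 ≤ q := by positivity
  -- `q` is the ratio of consecutive levels: twice as many increments, with smaller moments
  have hq1 : q < 1 := by
    have e1 : r⁻¹ * (1 / 2 : ℝ) ^ H = (1 / 2 : ℝ) ^ (H - γ) := by
      rw [hr, Real.rpow_sub (by norm_num)]; ring
    have e2 : (1 / 2 : ℝ) ^ (p * (H - γ)) < (1 / 2 : ℝ) ^ (1 : ℝ) :=
      Real.rpow_lt_rpow_of_exponent_gt (by norm_num) (by norm_num) hp1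
    rw [hq, e1, ← Real.rpow_mul_natCast (by norm_num), mul_comm (H - γ)]
    rw [Real.rpow_one] at e2
    linarith
  have hint : ∀ n i, ∫⁻ ω, Z n i ω ∂P
      = ENNReal.ofReal ((T ^ H) ^ p * ((r⁻¹ * (1 / 2 : ℝ) ^ H) ^ p) ^ n) * c := by
    intro n i
    have e : |(τ n (i + 1) : ℝ) - τ n i| = T * (1 / 2) ^ n := by
      rw [hτ', hτ']
      push_cast
      rw [← mul_sub, ← sub_div, add_sub_cancel_left, one_div_pow, abs_of_pos (by positivity)]
    have e' : ((1 / 2 : ℝ) ^ n) ^ H = ((1 / 2 : ℝ) ^ H) ^ n := by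
      rw [← Real.rpow_natCast_mul (by norm_num), ← Real.rpow_mul_natCast (by norm_num), mul_comm]
    simp only [hZ]
    rw [lintegral_const_mul' _ _ ENNReal.ofReal_ne_top, hX.lintegral_enorm_sub_pow hH, ← mul_assoc,
      ← ENNReal.ofReal_mul (by positivity), e, Real.mul_rpow hT.le (by positivity), e']
    congr 2
    rw [mul_pow, mul_pow, mul_pow, ← pow_mul, ← pow_mul, ← pow_mul, ← pow_mul, mul_comm n p]
    ring
  have hfin : ∫⁻ ω, ∑' n, ∑ i ∈ Finset.range (2 ^ n), Z n i ω ∂P ≠ ⊤ := by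
    rw [lintegral_tsum fun n => Finset.aemeasurable_fun_sum _ fun i _ => hmeas n i]
    have e : ∀ n, ∫⁻ ω, ∑ i ∈ Finset.range (2 ^ n), Z n i ω ∂P
        = ENNReal.ofReal ((T ^ H) ^ p * q ^ n) * c := by
      intro n
      rw [lintegral_finsetSum' _ fun i _ => hmeas n i, Finset.sum_congr rfl fun i _ => hint n i,
        Finset.sum_const, Finset.card_range, nsmul_eq_mul, ← mul_assoc]
      congr 1
      rw [← ENNReal.ofReal_natCast, ← ENNReal.ofReal_mul (by positivity)]
      congr 1
      rw [hq, mul_pow]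
      push_cast
      ring
    simp only [e]
    rw [ENNReal.tsum_mul_right]
    refine ENNReal.mul_ne_top ?_ (lintegral_enorm_pow_gaussianReal_lt_top p).ne
    rw [← ENNReal.ofReal_tsum_of_nonneg (fun n => by positivity)
      ((summable_geometric_of_lt_one hq0 hq1).mul_left _)]
    exact ENNReal.ofReal_ne_top
  have hae := ae_lt_top' (AEMeasurable.tsum fun n =>
    Finset.aemeasurable_fun_sum (Finset.range (2 ^ n)) fun i _ => hmeas n i) hfin
  filter_upwards [hae, hX.continuous] with ω hω hcont
  set S := (∑' n, ∑ i ∈ Finset.range (2 ^ n), Z n i ω).toReal with hS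
  have hS0 : 0 ≤ S := ENNReal.toReal_nonneg
  have hle : ∀ n i : ℕ, i < 2 ^ n →
      |X (τ n (i + 1)) ω - X (τ n i) ω| ≤ (S + 1) * r ^ n := by
    intro n i hi
    have h1 : Z n i ω ≤ ∑' n, ∑ i ∈ Finset.range (2 ^ n), Z n i ω :=
      (Finset.single_le_sum (f := fun i => Z n i ω) (fun _ _ => zero_le)
        (Finset.mem_range.2 hi)).trans (ENNReal.le_tsum n)
    have h2 := ENNReal.toReal_mono hω.ne h1
    have h3 : (Z n i ω).toReal = (r⁻¹ ^ n * |X (τ n (i + 1)) ω - X (τ n i) ω|) ^ p := by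
      simp only [hZ]
      rw [ENNReal.toReal_mul, ENNReal.toReal_ofReal (by positivity), ENNReal.toReal_pow,
        toReal_enorm, Real.norm_eq_abs, mul_pow]
    rw [h3] at h2
    have h4 : S ≤ (S + 1) ^ p :=
      (by linarith : S ≤ S + 1).trans (le_self_pow₀ (by linarith) hp0)
    have h5 := (pow_le_pow_iff_left₀ (by positivity) (by positivity) hp0).1 (h2.trans h4)
    rwa [inv_pow, inv_mul_le_iff₀ (by positivity), mul_comm] at h5
  have hpath : Continuous (samplePath X ω) := hcont.comp continuous_real_toNNReal
  obtain ⟨C, hC⟩ := exists_holderBound_of_dyadic (f := fun u => samplePath X ω (T * u)) hγ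
    (by positivity : 0 ≤ S + 1) (by fun_prop) fun n i hi => by
      have := hle n i hi
      simpa [samplePath, hτ, hr] using this
  refine ⟨C * (T⁻¹) ^ γ, fun s t hs hst ht => ?_⟩
  have h1 := hC (T⁻¹ * s) (T⁻¹ * t) (by positivity) (by gcongr)
    (by rw [inv_mul_le_iff₀ hT]; linarith)
  beta_reduce at h1
  rwa [mul_inv_cancel_left₀ hT.ne', mul_inv_cancel_left₀ hT.ne', ← mul_sub,
    Real.mul_rpow (by positivity) (sub_nonneg.2 hst), ← mul_assoc] at h1

/-- The event of probability one can be chosen independently of `T` and `γ`, because it is enough to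
consider integer times and rational exponents. -/
lemma IsFractionalBrownian.ae_forall_exists_holderBound {n : ℕ} (hH : 0 < H)
    {B : ℝ≥0 → Ω → EuclideanSpace ℝ (Fin n)}
    (hB : IsFractionalBrownian H B P) :
    ∀ᵐ ω ∂P, ∀ T γ : ℝ, 0 < γ → γ < H → ∃ C, HolderBound 0 T γ C (samplePath B ω) := by
  have hae : ∀ᵐ ω ∂P, ∀ (i : Fin n) (N : ℕ) (q : ℚ), (0 : ℝ) < q → (q : ℝ) < H →
      ∃ C, HolderBound 0 (N + 1) q C (samplePath (fun t ω => B t ω i) ω) := by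
    refine ae_all_iff.2 fun i => ae_all_iff.2 fun N => ae_all_iff.2 fun q => ?_
    by_cases hq : (0 : ℝ) < q ∧ (q : ℝ) < H
    · filter_upwards [(hB.component i).ae_exists_holderBound hH hq.1 hq.2
        (by positivity : (0 : ℝ) < N + 1)] with ω hω _ _ using hω
    · exact .of_forall fun ω h1 h2 => absurd ⟨h1, h2⟩ hq
  filter_upwards [hae] with ω hω T γ hγ hγH
  obtain ⟨q, hγq, hqH⟩ := exists_rat_btwn hγH
  obtain ⟨N, hN⟩ := exists_nat_ge T
  have hcomp : ∀ i : Fin n, ∃ C, HolderBound 0 (N + 1) q C fun t => samplePath B ω t i :=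
    fun i => hω i N q (hγ.trans hγq) hqH
  choose C hC using hcomp
  exact ⟨_, (HolderBound.euclidean hC).mono_exponent (by linarith) hγ hγq.le⟩

end FractionalBrownianPaths

end YoungVolterra

theorem corollary3p5 {Ω : Type*} [MeasurableSpace Ω] (P : Measure Ω) [IsProbabilityMeasure P]
    [P.IsComplete] {n : ℕ} {H : ℝ} (hH : 1 / 2 < H) (hH' : H < 1)
    (B : ℝ≥0 → Ω → EuclideanSpace ℝ (Fin n)) (hB : YoungVolterra.IsFractionalBrownian H B P) :
    ∀ᵐ ω ∂P, ∀ T : ℝ, 0 < T → ∀ γ : ℝ, 1 / 2 < γ → γ < H →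
      YoungVolterra.MemC₁ T γ (YoungVolterra.samplePath B ω) ∧
      ∀ (d : ℕ) (κ : ℝ), 0 < κ → κ < 1 → 1 < κ * (1 + γ) →
        ∀ (a : EuclideanSpace ℝ (Fin d))
          (σ : ℝ × ℝ × EuclideanSpace ℝ (Fin d) →
            EuclideanSpace ℝ (Fin n) →L[ℝ] EuclideanSpace ℝ (Fin d)),
          YoungVolterra.MemCkbHolder 2 κ (Icc 0 T ×ˢ Icc 0 T ×ˢ univ) σ →
          ∃ y : ℝ → EuclideanSpace ℝ (Fin d),
            (YoungVolterra.MemC₁ T γ y ∧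
              YoungVolterra.IsSolution T σ a (YoungVolterra.samplePath B ω) y) ∧
            ∀ y' : ℝ → EuclideanSpace ℝ (Fin d),
              YoungVolterra.MemC₁ T γ y' →
              YoungVolterra.IsSolution T σ a (YoungVolterra.samplePath B ω) y' →
              EqOn y' y (Icc 0 T) := by
  filter_upwards [hB.ae_forall_exists_holderBound (by linarith)] with ω hω T hT γ hγ hγH
  have hγ0 : 0 < γ := by linarith
  obtain ⟨C, hC⟩ := hω T γ hγ0 hγH
  refine ⟨hC.memC₁ hγ0, fun d κ hκ hκ1 hκγ a σ hσ => ?_⟩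
  exact YoungVolterra.exists_unique_isSolution hT hγ (hγH.trans hH') hκ (by nlinarith)
    (abs_nonneg C) hC.abs a hσ
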